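/- **Notation.** For an integer $p$ let $K_p$ be the twist knot with $p$ full twists: its standard diagram consists of a clasp with two negative crossings and a row of $2|p|$ crossings of two antiparallel strands, which are negative for $p>0$ and positive for $p<0$. (So $K_0$ is the unknot, $K_1$ the left-handed trefoil, $K_{-1}$ the figure eight knot.) Let $\mu$ and $\lambda$ be the meridian and the preferred longitude in the knot group $\pi_1(M_K)$ of a knot $K$, and consider the set of all $(l,m)\in\mathbb C^2$ for which there is a representation $\rho:\pi_1(M_K)\to SL_2(\mathbb C)$ with $\rho(\mu)=\begin{pmatrix} m&*\\0&m^{-1}\end{pmatrix}$ and $\rho(\lambda)=\begin{pmatrix} l&*\\0&l^{-1}\end{pmatrix}$. The A-polynomial of $K$ is the product of the defining polynomials of the one-dimensional irreducible components of the Zariski closure of this set in $\mathbb C^2$, normalized to be a polynomial in $\mathbb Z[l,m]$ with coprime coefficients; it is determined up to sign. Let $A_K(l,m)$ be the A-polynomial of $K$ divided by its factor $l-1$. Put $(a)_n=(1-a)(1-a^2)\cdots(1-a^n)$, and for integers $0\le l\le k<n$ let $$F(n,k,l)=(-1)^{k+1}q^{k(k+3)/2}q^{nk}\,\frac{(q^{-1})_{n+k}(q^{-1})_{n-1}}{(q^{-1})_n(q^{-1})_{n-k-1}}\,(-1)^l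 q^{l(l+1)p+l(l-1)/2}(q^{2l+1}-1)\,\frac{(q)_k}{(q)_{k+l+1}(q)_{k-l}}$$ be the summand in Masbaum's formula $J_{K_p}(n)=\sum_{k,l}F(n,k,l)$ for the colored Jones polynomial of $K_p$. Define rational functions by $$f_0(q,Q,X,Y)=X\,\frac{(1-q^{-1}Q^{-1}X^{-1})(1-Q^{-1})}{(1-q^{-1}Q^{-1})(1-Q^{-1}X)},$$ $$f_1(q,Q,X,Y)=-q^{2}XQ\,\frac{(1-q^{-1}Q^{-1}X^{-1})(1-qQ^{-1}X)(1-qX)}{(1-q^{2}XY)(1-qXY^{-1})},$$ $$f_2(q,Q,X,Y)=-q^{2p}Y^{2p+1}\,\frac{(q^{3}Y^2-1)(1-XY^{-1})}{(qY^2-1)(1-q^{2}XY)}.$$ The specialization $f_i(1,Q,X,Y)$ is taken as a rational function of $Q,X,Y$; an equation $f_i(1,m^2,x,y)=c$ means that this rational function is defined at $(m^2,x,y)$ and has the value $c$ there. **Theorem.** (a) For all integers $p$ and $0\le l\le k<n$, $F(n,k,l)\ne0$ in $\mathbb Q(q)$, and $$\frac{F(n+1,k,l)}{F(n,k,l)}=f_0(q,q^n,q^k,q^l),\qquad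 \frac{F(n,k+1,l)}{F(n,k,l)}=f_1(q,q^n,q^k,q^l),\qquad \frac{F(n,k,l+1)}{F(n,k,l)}=f_2(q,q^n,q^k,q^l),$$ where $k+1<n$ is assumed in the second and $l+1\le k$ in the third equation. (b) There are $h_p\in\mathbb Z[m^{\pm1},x]$, $p\in\mathbb Z$, with $$h_0=1,\qquad h_1=\frac{m^4-xm^2+1}{m^2},\qquad h_p=\frac{m^4-xm^4+x^2m^2+m^2+1-x}{m^2}\,h_{p-1}-h_{p-2}\quad\text{for all } p\in\mathbb Z,$$ such that for every integer $p$ the following two statements hold. 1. Let $m,l,x,y$ be elements of a field (for example complex numbers, or indeterminates and functions of them) with $m,x,y\neq0$, and suppose that $$f_0(1,m^2,x,y)=l,\qquad f_1(1,m^2,x,y)=1,\qquad f_2(1,m^2,x,y)=1 .$$ Then $x(m^2+l)=lm^2+1$, hence $x=\dfrac{lm^2+1}{m^2+l}$ if $m^2+l\ne0$, and $$(y+1)(1-x)\,y^p\,h_p(m,x)=0 .$$ 2. Put, in the field $\mathbb Q(l,m)$, $$B_{K_p}(l,m):=\begin{cases}(m^2+l)^{2p-1}(m^2)^p\,h_p\!\left(m,\frac{lm^2+1}{m^2+l}\right),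 & p>0,\\[1ex] (m^2+l)^{2|p|}(m^2)^{|p|}\,h_p\!\left(m,\frac{lm^2+1}{m^2+l}\right), & p\le 0.\end{cases}$$ Then $B_{K_p}(l,m)$ is a polynomial in $\mathbb Z[l,m]$ and $B_{K_p}(l,m)=A_{K_p}(l,m)$ (up to the sign that is left open in the definition of the A-polynomial). -/

import Mathlib

open scoped Polynomial LaurentPolynomial MatrixGroups

noncomputable section

/-! ## Knots through diagrams: knot group, meridian, preferred longitude -/

/-- The crossing code of an oriented knot diagram with `n + 1` crossings. Walking along the knot
cuts the diagram, at its undercrossings, into arcs `0, 1, …, n` (indices are cyclic). Arc `i` ends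
at an undercrossing, where the knot passes below arc `overArc i` and then continues as arc `i + 1`;
`sign i` is the sign of that crossing. -/
structure KnotDiagram where
  n : ℕ
  overArc : Fin (n + 1) → Fin (n + 1)
  sign : Fin (n + 1) → ℤˣ

namespace KnotDiagram

variable (D : KnotDiagram)

/-- The Wirtinger letter read off when the knot passes below an arc at the end of arc `i`. -/
def letter (i : Fin (D.n + 1)) : FreeGroup (Fin (D.n + 1)) :=
  FreeGroup.of (D.overArc i) ^ ((D.sign i : ℤˣ) : ℤ)

/-- The Wirtinger relator at the end of arc `i`, which says `x_{i+1} = w_i⁻¹ x_i w_i`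
where `w_i` is the letter at the end of arc `i`. -/
def relator (i : Fin (D.n + 1)) : FreeGroup (Fin (D.n + 1)) :=
  (D.letter i)⁻¹ * FreeGroup.of i * D.letter i * (FreeGroup.of (i + 1))⁻¹

/-- The group of the knot, `π₁` of the complement, by its Wirtinger presentation. The generator
of an arc is a loop that has linking number `+1` with the knot; loops are composed from left to
right. -/
abbrev knotGroup : Type := PresentedGroup (Set.range D.relator)

/-- The writhe of the diagram: the sum of the signs of its crossings. -/
def writhe : ℤ := ∑ i, ((D.sign i : ℤˣ) : ℤ)

/-- The meridian: the Wirtinger generator of arc `0`. -/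
def meridian : D.knotGroup := PresentedGroup.of 0

/-- The preferred longitude, commuting with the meridian: the letters read along one full turn
around the knot from arc `0`, corrected by a power of the meridian such that the
linking number with the knot is `0`. -/
def longitude : D.knotGroup :=
  PresentedGroup.mk _ (List.ofFn D.letter).prod * D.meridian ^ (-D.writhe)

/-! ## The A-polynomial

Points of `ℂ²` are maps `Fin 2 → ℂ`; coordinate `0` is `l` and coordinate `1` is `m`. -/

/-- The set of all `(l, m)` such that some representation of the knot group in `SL₂(ℂ)` sends the
meridian and the longitude to upper triangular matrices whose upper left entries are
`m` and `l`, respectively. -/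
def eigenvalueSet : Set (Fin 2 → ℂ) :=
  {v | ∃ ρ : D.knotGroup →* SL(2, ℂ),
    (ρ D.meridian) 1 0 = 0 ∧ (ρ D.longitude) 1 0 = 0 ∧
    v 1 = (ρ D.meridian) 0 0 ∧ v 0 = (ρ D.longitude) 0 0}

end KnotDiagram

/-- The prime ideals of the one-dimensional irreducible components of the Zariski closure of
`S ⊆ ℂ²`. The closure is the zero set of the vanishing ideal of `S`, its irreducible components
are the zero sets of the minimal primes over that ideal, and the dimension
of a component is the Krull dimension of its coordinate ring. -/
def curveComponents (S : Set (Fin 2 → ℂ)) : Set (Ideal (MvPolynomial (Fin 2) ℂ)) :=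
  {𝔭 | 𝔭 ∈ (MvPolynomial.vanishingIdeal ℂ S).minimalPrimes ∧
    ringKrullDim (MvPolynomial (Fin 2) ℂ ⧸ 𝔭) = 1}

/-- `P ∈ ℤ[l, m]` is the A-polynomial of the knot with diagram `D`: it is the product of one
defining polynomial for each one-dimensional irreducible component of the Zariski closure of the
eigenvalue set, normalized to have coprime integer coefficients. This determines `P` up to sign
(the components are finitely many, so the product is an honest finite one, and defining
polynomials are unique up to constants). -/
def IsAPolynomial (D : KnotDiagram) (P : MvPolynomial (Fin 2) ℤ) : Prop :=
  (∀ c : ℤ, MvPolynomial.C c ∣ P → IsUnit c) ∧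
  ∃ f : Ideal (MvPolynomial (Fin 2) ℂ) → MvPolynomial (Fin 2) ℂ,
    (∀ 𝔭 ∈ curveComponents D.eigenvalueSet, 𝔭 = Ideal.span {f 𝔭}) ∧
    MvPolynomial.map (Int.castRingHom ℂ) P = ∏ᶠ 𝔭 ∈ curveComponents D.eigenvalueSet, f 𝔭

/-- `P` is the A-polynomial divided by its factor `l - 1`. -/
def IsReducedAPolynomial (D : KnotDiagram) (P : MvPolynomial (Fin 2) ℤ) : Prop :=
  IsAPolynomial D ((MvPolynomial.X 0 - 1) * P)

/-! ## Twist knots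

The diagram of `K_p` has a row of `2|p|` crossings `c₁, …, c_{2|p|}` (`|p|` full twists) of two
antiparallel strands, and a clasp with two negative crossings `b`, `t`. The crossings `c_i` are
negative for `p > 0` and positive for `p < 0`. The knot runs through
`c₁, c₂, …, c_{2|p|}, b, t, c_{2|p|}, …, c₂, c₁, t, b`, in this order. It is below at the first
passage of `b` and the second passage of `t`. For `p > 0` its first passage of `c_i` is above for
odd `i` and below for even `i`; for `p < 0` it is the other way round. So `K₀` is the unknot,
`K₁` the left-handed trefoil and `K₋₁` the figure eight knot (with alternating diagram).

With `r = |p|`, the arcs `0, …, r - 1` end at those `c_i` that are undercrossings in the first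
passage, arc `r` ends at `b`, the arcs `r + 1, …, 2 r` end at the remaining `c_i`, and
arc `2 r + 1` ends at `t`. -/

/-- The standard diagram of the twist knot `K_p`. -/
def twistKnot (p : ℤ) : KnotDiagram where
  n := 2 * p.natAbs + 1
  overArc i :=
    if i.val = p.natAbs then 0
    else if i.val = 2 * p.natAbs + 1 then ⟨p.natAbs + 1, by omega⟩
    else if 0 ≤ p then ⟨2 * p.natAbs - i.val, by omega⟩
    else ⟨2 * p.natAbs + 1 - i.val, by omega⟩
  sign i :=
    if i.val = p.natAbs ∨ i.val = 2 * p.natAbs + 1 ∨ 0 ≤ p then -1 else 1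

/-! ## The summand of the colored Jones polynomial and its ratios -/

section Summand

variable {K : Type*} [Field K]

/-- `(a)_n = (1 - a)(1 - a²) ⋯ (1 - aⁿ)`. -/
def qFact (a : K) (n : ℕ) : K := ∏ i ∈ Finset.range n, (1 - a ^ (i + 1))

/-- The summand `F(n, k, l)`, for `l ≤ k < n`, in Masbaum's formula
`J_{K_p}(n) = ∑_k ∑_l F(n, k, l)` for the colored Jones polynomial of `K_p`. -/
def masbaumF (p : ℤ) (q : K) (n k l : ℕ) : K :=
  (-1) ^ (k + 1) * q ^ (k * (k + 3) / 2) * q ^ (n * k)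
    * ((qFact q⁻¹ (n + k) * qFact q⁻¹ (n - 1)) / (qFact q⁻¹ n * qFact q⁻¹ (n - k - 1)))
    * (-1) ^ l * q ^ (((l * (l + 1) : ℕ) : ℤ) * p + ((l * (l - 1) / 2 : ℕ) : ℤ))
    * (q ^ (2 * l + 1) - 1)
    * (qFact q k / (qFact q (k + l + 1) * qFact q (k - l)))

/-- The rational function `f₀(q, Q, X, Y)`. -/
def ratio0 (q Q X _Y : K) : K :=
  X * ((1 - q⁻¹ * Q⁻¹ * X⁻¹) * (1 - Q⁻¹)) / ((1 - q⁻¹ * Q⁻¹) * (1 - Q⁻¹ * X))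

/-- The rational function `f₁(q, Q, X, Y)`. -/
def ratio1 (q Q X Y : K) : K :=
  -(q ^ 2 * X * Q) * ((1 - q⁻¹ * Q⁻¹ * X⁻¹) * (1 - q * Q⁻¹ * X) * (1 - q * X))
    / ((1 - q ^ 2 * X * Y) * (1 - q * X * Y⁻¹))

/-- The rational function `f₂(q, Q, X, Y)`. -/
def ratio2 (p : ℤ) (q _Q X Y : K) : K :=
  -(q ^ (2 * p) * Y ^ (2 * p + 1)) * ((q ^ 3 * Y ^ 2 - 1) * (1 - X * Y⁻¹))
    / ((q * Y ^ 2 - 1) * (1 - q ^ 2 * X * Y))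

end Summand

/-- The field `ℚ(Q, X, Y)` of rational functions in three variables. -/
abbrev RatQXY : Type := FractionRing (MvPolynomial (Fin 3) ℤ)

/-- The variables `Q`, `X`, `Y` of `ℚ(Q, X, Y)`, for `i = 0, 1, 2`. -/
def varQXY (i : Fin 3) : RatQXY := algebraMap (MvPolynomial (Fin 3) ℤ) RatQXY (MvPolynomial.X i)

/-- The specialization `f₀(1, Q, X, Y) ∈ ℚ(Q, X, Y)`: the denominator of `f₀` does not vanish
identically at `q = 1`, so `q = 1` may be substituted at the generic point. -/
def spec0 : RatQXY := ratio0 1 (varQXY 0) (varQXY 1) (varQXY 2)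

/-- The specialization `f₁(1, Q, X, Y) ∈ ℚ(Q, X, Y)`. -/
def spec1 : RatQXY := ratio1 1 (varQXY 0) (varQXY 1) (varQXY 2)

/-- The specialization `f₂(1, Q, X, Y) ∈ ℚ(Q, X, Y)`. -/
def spec2 (p : ℤ) : RatQXY := ratio2 p 1 (varQXY 0) (varQXY 1) (varQXY 2)

/-- The rational function `g` is defined at the point `v` and has the value `c` there:
`g` is a quotient of two polynomials, the denominator not vanishing at `v`. -/
def HasValueAt {K : Type*} [Field K] (g : RatQXY) (v : Fin 3 → K) (c : K) : Prop :=
  ∃ N D : MvPolynomial (Fin 3) ℤ,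
    g = algebraMap _ RatQXY N / algebraMap _ RatQXY D ∧
    MvPolynomial.aeval v D ≠ 0 ∧
    c = MvPolynomial.aeval v N / MvPolynomial.aeval v D

/-! ## The polynomials `h_p ∈ ℤ[m^{±1}, x]` and `B_{K_p}`

In `ℤ[T;T⁻¹][X]` the Laurent variable `T` is `m` and the polynomial variable `X` is `x`. -/

/-- The value `h(m, x)` of `h ∈ ℤ[m^{±1}, x]` in a field, for `m ≠ 0`. -/
def evalAt {K : Type*} [Field K] (m : K) (hm : m ≠ 0) (x : K) (h : ℤ[T;T⁻¹][X]) : K :=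
  Polynomial.eval₂ (LaurentPolynomial.eval₂ (Int.castRingHom K) (Units.mk0 m hm)) x h

/-- The field `ℚ(l, m)` of rational functions in two variables. -/
abbrev RatLM : Type := FractionRing (MvPolynomial (Fin 2) ℤ)

/-- The variable `l` of `ℚ(l, m)`. -/
def varL : RatLM := algebraMap (MvPolynomial (Fin 2) ℤ) RatLM (MvPolynomial.X 0)

/-- The variable `m` of `ℚ(l, m)`. -/
def varM : RatLM := algebraMap (MvPolynomial (Fin 2) ℤ) RatLM (MvPolynomial.X 1)

theorem varM_ne_zero : varM ≠ 0 := by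
  intro h
  exact MvPolynomial.X_ne_zero (R := ℤ) (1 : Fin 2)
    ((IsFractionRing.injective (MvPolynomial (Fin 2) ℤ) RatLM) (h.trans (map_zero _).symm))

/-- The rational function `B_{K_p}(l, m)` formed from `h = h_p`. -/
def twistB (p : ℤ) (h : ℤ[T;T⁻¹][X]) : RatLM :=
  if 0 < p then
    (varM ^ 2 + varL) ^ (2 * p - 1) * (varM ^ 2) ^ p
      * evalAt varM varM_ne_zero ((varL * varM ^ 2 + 1) / (varM ^ 2 + varL)) h
  else
    (varM ^ 2 + varL) ^ (2 * |p|) * (varM ^ 2) ^ |p|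
      * evalAt varM varM_ne_zero ((varL * varM ^ 2 + 1) / (varM ^ 2 + varL)) h

end

/-!
The statements about the summand are identities between `q`-factorials. The rest rests on one
parameter. Put `M = m² + m⁻²` and `c = M (1 - x) + x² + 1`, which is the coefficient in the recursion
for `h_p`. So `h_p = S_{p-1}(c) (M - x) - S_{p-2}(c)` with the Chebyshev polynomials `S_k`, and
`(1 - x) h_p = ((c - 1) S_{p-1} - S_{p-2}) - x (S_{p-1} - S_{p-2})` (`one_sub_mul_twistH`).

*The three equations.* After cancellation, the first one says `x (m² + l) = l m² + 1`, the second
one `y + y⁻¹ = c`, and the third one `1 - x y = -y^{2p} (y - x)`. As the values `S_k(c)` are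
geometric in `y`, the third one is the vanishing of `(y + 1) (1 - x) y^p h_p`
(`twistH_eq_of_trace`).

*The knot group.* Colours that satisfy the Wirtinger relations are conjugated by powers of
`u = a⁻¹ b` along the twist region, where `a` and `b` are the colours that enter it. So the group is
generated by `a` and `b` with the single relation `w b = a w`, `w = u^p b u^{-p}`, and the longitude
is a word in `a` and `b` (`exists_hom_twistKnot_iff`).

*Representations.* If `ρ(a)` is upper triangular and the representation is not, then up to
conjugation `(ρ(a), ρ(b))` is a Riley pair, and `ρ(u)` has a trace `t`. By Cayley-Hamilton, powers of
`ρ(u)` are linear in `ρ(u)` with coefficients `S_k(t)`, so that the relation becomes a single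
equation, the vanishing of the Riley polynomial in `M` and `t`, and the eigenvalue `l` of the
longitude is a quotient of expressions in `m²`, `S_{p-1}(t)` and `S_{p-2}(t)`. In terms of
`x = ((t - 1) S_{p-1} - S_{p-2}) / (S_{p-1} - S_{p-2})` the latter says `x (m² + l) = l m² + 1`, and
the Riley equation says `t = c` for `t ≠ 2`; hence `h_p(m, x) = 0` by the formula above. Reducible
representations, and those with `t = 2`, give `l = 1`. The converse holds for
`m ≠ 0`, `m⁴ ≠ 1`. So the eigenvalue set is
contained in the curve `(l - 1) B_{K_p} = 0` (`twistA_eq_zero_of_mem_eigenvalueSet`), and it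
contains the points of the curve with `m ≠ 0`, `m⁴ ≠ 1` (`mem_eigenvalueSet_of_twistA_eq_zero`).
No line `m = const` lies on the curve, so that, by the Nullstellensatz, the components of the
closure of the eigenvalue set are the zero sets of the irreducible factors of `(l - 1) B_{K_p}`.

*Multiplicities.* It remains to see that `(l - 1) B_{K_p}` is squarefree. The factor `l - 1` occurs
once because `B_{K_p}` is a power of `2` at `l = m = 1`. At a point with `B_{K_p} = 0`, `l ≠ 1`,
`m ≠ 0`, `m⁴ ≠ 1` there is a tangent vector, written with dual numbers, along which `c` is
constant but `x` is not. As `(1 - x) h_p` is linear in `x` for constant `c`, with the coefficient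
`S_{p-1} - S_{p-2} ≠ 0`, the derivative of `B_{K_p}` along it is not zero
(`exists_dualNumber_twistA_ne_zero`), which excludes a square factor. Finally, the value `-1` of
`(l - 1) B_{K_p}` at `l = 0`, `m = 1` shows that its coefficients are coprime.
-/

/-! ### Ratios of neighbouring summands -/

section Summand

variable {K : Type*} [Field K]

theorem qFact_succ (a : K) (n : ℕ) : qFact a (n + 1) = qFact a n * (1 - a ^ (n + 1)) :=
  Finset.prod_range_succ _ _

theorem qFact_ne_zero {a : K} (ha : ∀ j : ℕ, 0 < j → a ^ j ≠ 1) (n : ℕ) : qFact a n ≠ 0 :=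
  Finset.prod_ne_zero_iff.2 fun i _ => sub_ne_zero.2 (ha (i + 1) i.succ_pos).symm

variable {q : K} (hq0 : q ≠ 0) (hq : ∀ j : ℕ, 0 < j → q ^ j ≠ 1)
include hq0 hq

theorem masbaumF_ne_zero (p : ℤ) (n k l : ℕ) : masbaumF p q n k l ≠ 0 := by
  have hi : ∀ j : ℕ, 0 < j → q⁻¹ ^ j ≠ 1 := fun j hj h =>
    hq j hj (by rwa [inv_pow, inv_eq_one] at h)
  have h1 : q ^ (2 * l + 1) - 1 ≠ 0 := sub_ne_zero.2 (hq _ (by omega))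
  unfold masbaumF
  have h3 := zpow_ne_zero (((l * (l + 1) : ℕ) : ℤ) * p + ((l * (l - 1) / 2 : ℕ) : ℤ)) hq0
  refine mul_ne_zero (mul_ne_zero (mul_ne_zero (mul_ne_zero (mul_ne_zero ?_ ?_) ?_) h3) h1) ?_ <;>
    simp [hq0, qFact_ne_zero hi, qFact_ne_zero hq]

theorem masbaumF_ratio0 (p : ℤ) {n k : ℕ} (l : ℕ) (hkn : k < n) :
    masbaumF p q (n + 1) k l / masbaumF p q n k l = ratio0 q (q ^ n) (q ^ k) (q ^ l) := by
  rw [div_eq_iff (masbaumF_ne_zero hq0 hq p n k l)]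
  have hi : ∀ j : ℕ, 0 < j → q⁻¹ ^ j ≠ 1 := fun j hj h =>
    hq j hj (by rwa [inv_pow, inv_eq_one] at h)
  obtain ⟨d, rfl⟩ := Nat.exists_eq_add_of_lt hkn
  unfold masbaumF ratio0
  have e1 : k + d + 1 + 1 + k = (k + d + 1 + k) + 1 := by ring
  have e2 : k + d + 1 + 1 - 1 = k + d + 1 := by omega
  have e3 : k + d + 1 - 1 = k + d := by omega
  have e4 : k + d + 1 + 1 - k - 1 = d + 1 := by omega
  have e5 : k + d + 1 - k - 1 = d := by omega
  rw [e1, e2, e3, e4, e5, qFact_succ _ (k + d + 1 + k), qFact_succ _ (k + d + 1),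
    qFact_succ _ (k + d), qFact_succ _ d]
  have g1 := sub_ne_zero.2 (hi (k + d + 1 + 1) (by omega)).symm
  have g2 := sub_ne_zero.2 (hi (k + d + 1) (by omega)).symm
  have g3 := sub_ne_zero.2 (hi (d + 1) (by omega)).symm
  have f1 := qFact_ne_zero hi (k + d)
  have f2 := qFact_ne_zero hi d
  have i1 : 1 - q⁻¹ * (q ^ (k + d + 1))⁻¹ = 1 - q⁻¹ ^ (k + d + 1 + 1) := by
    rw [pow_succ q⁻¹, inv_pow, mul_comm]
  have i2 : 1 - (q ^ (k + d + 1))⁻¹ * q ^ k = 1 - q⁻¹ ^ (d + 1) := by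
    rw [inv_pow]; congr 1; rw [inv_mul_eq_iff_eq_mul₀ (pow_ne_zero _ hq0)]
    rw [eq_mul_inv_iff_mul_eq₀ (pow_ne_zero _ hq0)]; ring
  have i3 : 1 - q⁻¹ * (q ^ (k + d + 1))⁻¹ * (q ^ k)⁻¹ = 1 - q⁻¹ ^ (k + d + 1 + k + 1) := by
    rw [pow_succ q⁻¹, pow_add q⁻¹ _ k, inv_pow, inv_pow]; ring
  have i4 : 1 - (q ^ (k + d + 1))⁻¹ = 1 - q⁻¹ ^ (k + d + 1) := by rw [inv_pow]
  rw [i1, i2, i3, i4]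
  have e6 : q ^ ((k + d + 1 + 1) * k) = q ^ ((k + d + 1) * k) * q ^ k := by
    rw [← pow_add]; ring_nf
  rw [e6]
  clear i1 i2 i3 i4 e6 hi
  generalize 1 - q⁻¹ ^ (k + d + 1 + 1) = x1 at *
  generalize 1 - q⁻¹ ^ (k + d + 1) = x2 at *
  generalize 1 - q⁻¹ ^ (d + 1) = x3 at *
  generalize 1 - q⁻¹ ^ (k + d + 1 + k + 1) = x4 at *
  generalize qFact q⁻¹ (k + d) = y1 at *
  generalize qFact q⁻¹ d = y2 at *
  generalize qFact q⁻¹ (k + d + 1 + k) = y3 at *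
  generalize qFact q k / _ = y4
  generalize q ^ (_ + _ : ℤ) = z1
  generalize q ^ (2 * l + 1) - 1 = z2
  generalize q ^ (k * (k + 3) / 2) = z3
  generalize q ^ ((k + d + 1) * k) = z4
  generalize q ^ k = z5
  generalize (-1 : K) ^ (k + 1) = z6
  generalize (-1 : K) ^ l = z7
  have a1 : y3 * x4 * (y1 * x2) / (y1 * x2 * x1 * (y2 * x3))
      = x4 * x2 / (x1 * x3) * (y3 * y1 / (y1 * x2 * y2)) := by field_simp
  rw [a1]
  generalize y3 * y1 / (y1 * x2 * y2) = w1
  ring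

theorem masbaumF_ratio1 (p : ℤ) {n k l : ℕ} (hlk : l ≤ k) (hkn : k + 1 < n) :
    masbaumF p q n (k + 1) l / masbaumF p q n k l = ratio1 q (q ^ n) (q ^ k) (q ^ l) := by
  rw [div_eq_iff (masbaumF_ne_zero hq0 hq p n k l)]
  have hi : ∀ j : ℕ, 0 < j → q⁻¹ ^ j ≠ 1 := fun j hj h =>
    hq j hj (by rwa [inv_pow, inv_eq_one] at h)
  obtain ⟨d, rfl⟩ := Nat.exists_eq_add_of_lt hkn
  obtain ⟨e, rfl⟩ := Nat.exists_eq_add_of_le hlk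
  unfold masbaumF ratio1
  set n := l + e + 1 + d + 1 with hn
  have e1 : n + (l + e + 1) = (n + (l + e)) + 1 := by ring
  have e2 : n - (l + e + 1) - 1 = d := by omega
  have e3 : n - (l + e) - 1 = d + 1 := by omega
  have e4 : l + e + 1 + l + 1 = (l + e + l + 1) + 1 := by ring
  have e5 : l + e + 1 - l = e + 1 := by omega
  have e6 : l + e - l = e := by omega
  rw [e1, e2, e3, e4, e5, e6, qFact_succ _ (n + (l + e)), qFact_succ _ d,
    qFact_succ _ (l + e + l + 1), qFact_succ _ e, qFact_succ _ (l + e)]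
  have g1 := sub_ne_zero.2 (hi (d + 1) (by omega)).symm
  have g2 := sub_ne_zero.2 (hq (l + e + l + 1 + 1) (by omega)).symm
  have g3 := sub_ne_zero.2 (hq (e + 1) (by omega)).symm
  have f1 := qFact_ne_zero hi n
  have f2 := qFact_ne_zero hi d
  have f3 := qFact_ne_zero hq (l + e + l + 1)
  have f4 := qFact_ne_zero hq e
  have i1 : 1 - q ^ 2 * q ^ (l + e) * q ^ l = 1 - q ^ (l + e + l + 1 + 1) := by ring
  have i2 : 1 - q * q ^ (l + e) * (q ^ l)⁻¹ = 1 - q ^ (e + 1) := by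
    congr 1; rw [mul_inv_eq_iff_eq_mul₀ (pow_ne_zero _ hq0)]; ring
  have i3 : 1 - q⁻¹ * (q ^ n)⁻¹ * (q ^ (l + e))⁻¹ = 1 - q⁻¹ ^ (n + (l + e) + 1) := by
    rw [pow_succ q⁻¹, pow_add q⁻¹ n, inv_pow, inv_pow]; ring
  have i4 : 1 - q * (q ^ n)⁻¹ * q ^ (l + e) = 1 - q⁻¹ ^ (d + 1) := by
    rw [inv_pow]; congr 1; rw [eq_comm, inv_eq_iff_eq_inv, mul_inv, mul_inv, inv_inv]
    have h0 : q ^ n = q ^ (d + 1) * (q * q ^ (l + e)) := by rw [hn]; ring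
    rw [h0]
    have := pow_ne_zero (l + e) hq0
    field_simp
  have i5 : 1 - q * q ^ (l + e) = 1 - q ^ (l + e + 1) := by ring
  rw [i1, i2, i3, i4, i5]
  have e7 : (l + e + 1) * (l + e + 1 + 3) / 2 = (l + e) * (l + e + 3) / 2 + (l + e + 2) := by
    rw [← Nat.add_mul_div_right _ _ (by norm_num : 0 < 2)]; congr 1; ring
  have e8 : q ^ ((l + e + 1) * (l + e + 1 + 3) / 2)
      = q ^ ((l + e) * (l + e + 3) / 2) * (q ^ 2 * q ^ (l + e)) := by
    rw [e7]; ring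
  have e9 : q ^ (n * (l + e + 1)) = q ^ (n * (l + e)) * q ^ n := by ring
  rw [e8, e9, pow_succ (-1 : K) (l + e + 1)]
  clear i1 i2 i3 i4 i5 e1 e2 e3 e4 e5 e6 e7 e8 e9 hi
  generalize 1 - q⁻¹ ^ (d + 1) = x1 at *
  generalize 1 - q ^ (l + e + l + 1 + 1) = x2 at *
  generalize 1 - q ^ (e + 1) = x3 at *
  generalize 1 - q⁻¹ ^ (n + (l + e) + 1) = x4 at *
  generalize qFact q⁻¹ n = y1 at *
  generalize qFact q⁻¹ d = y2 at *
  generalize qFact q⁻¹ (n + (l + e)) = y3 at *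
  generalize qFact q⁻¹ (n - 1) = y4 at *
  generalize qFact q (l + e + l + 1) = y5 at *
  generalize qFact q e = y6 at *
  generalize qFact q (l + e) = y7 at *
  generalize q ^ (_ + _ : ℤ) = z1
  generalize q ^ (2 * l + 1) - 1 = z2
  generalize q ^ ((l + e) * (l + e + 3) / 2) = z3
  generalize q ^ (n * (l + e)) = z4
  generalize 1 - q ^ (l + e + 1) = z5
  generalize q ^ (l + e) = z6
  generalize q ^ n = z7
  generalize (-1 : K) ^ (l + e + 1) = z8
  generalize (-1 : K) ^ l = z9
  have a1 : y3 * x4 * y4 / (y1 * y2) = x4 * x1 * (y3 * y4 / (y1 * (y2 * x1))) := by field_simp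
  have a2 : y7 * z5 / (y5 * x2 * (y6 * x3)) = z5 / (x2 * x3) * (y7 / (y5 * y6)) := by field_simp
  rw [a1, a2]
  generalize y3 * y4 / (y1 * (y2 * x1)) = w1
  generalize y7 / (y5 * y6) = w2
  ring

theorem masbaumF_ratio2 (p : ℤ) (n : ℕ) {k l : ℕ} (hlk : l + 1 ≤ k) :
    masbaumF p q n k (l + 1) / masbaumF p q n k l = ratio2 p q (q ^ n) (q ^ k) (q ^ l) := by
  rw [div_eq_iff (masbaumF_ne_zero hq0 hq p n k l)]
  have hi : ∀ j : ℕ, 0 < j → q⁻¹ ^ j ≠ 1 := fun j hj h =>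
    hq j hj (by rwa [inv_pow, inv_eq_one] at h)
  obtain ⟨e, rfl⟩ := Nat.exists_eq_add_of_le hlk
  unfold masbaumF ratio2
  have e1 : l + 1 + e + (l + 1) + 1 = (l + 1 + e + l + 1) + 1 := by ring
  have e2 : l + 1 + e - (l + 1) = e := by omega
  have e3 : l + 1 + e - l = e + 1 := by omega
  rw [e1, e2, e3, qFact_succ _ (l + 1 + e + l + 1), qFact_succ _ e]
  have g1 := sub_ne_zero.2 (hq (e + 1) (by omega)).symm
  have g2 := sub_ne_zero.2 (hq (l + 1 + e + l + 1 + 1) (by omega)).symm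
  have g3 : q ^ (2 * l + 1) - 1 ≠ 0 := sub_ne_zero.2 (hq _ (by omega))
  have f1 := qFact_ne_zero hq (l + 1 + e + l + 1)
  have f2 := qFact_ne_zero hq e
  have i1 : q * (q ^ l) ^ 2 - 1 = q ^ (2 * l + 1) - 1 := by ring
  have i2 : q ^ 3 * (q ^ l) ^ 2 - 1 = q ^ (2 * (l + 1) + 1) - 1 := by ring
  have i3 : 1 - q ^ 2 * q ^ (l + 1 + e) * q ^ l = 1 - q ^ (l + 1 + e + l + 1 + 1) := by ring
  have i4 : 1 - q ^ (l + 1 + e) * (q ^ l)⁻¹ = 1 - q ^ (e + 1) := by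
    congr 1; rw [mul_inv_eq_iff_eq_mul₀ (pow_ne_zero _ hq0)]; ring
  rw [i1, i2, i3, i4]
  have e7 : (l + 1) * (l + 1 - 1) / 2 = l * (l - 1) / 2 + l := by
    rw [← Nat.add_mul_div_right _ _ (by norm_num : 0 < 2)]; congr 1
    rcases l with _ | l
    · rfl
    · simp only [Nat.add_sub_cancel]; ring
  have e8 : q ^ ((((l + 1) * (l + 1 + 1) : ℕ) : ℤ) * p + (((l + 1) * (l + 1 - 1) / 2 : ℕ) : ℤ))
      = q ^ (((l * (l + 1) : ℕ) : ℤ) * p + ((l * (l - 1) / 2 : ℕ) : ℤ))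
        * (q ^ (2 * p) * (q ^ l) ^ (2 * p + 1)) := by
    rw [e7, ← zpow_natCast q l, ← zpow_mul, ← zpow_add₀ hq0, ← zpow_add₀ hq0]
    congr 1; push_cast; ring
  rw [e8, pow_succ (-1 : K) l]
  generalize 1 - q ^ (e + 1) = x1 at *
  generalize 1 - q ^ (l + 1 + e + l + 1 + 1) = x2 at *
  generalize q ^ (2 * l + 1) - 1 = x3 at *
  field_simp
  
end Summand

theorem ratFunc_X_pow_ne_one {j : ℕ} (hj : 0 < j) : (RatFunc.X : RatFunc ℚ) ^ j ≠ 1 := by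
  rw [← RatFunc.algebraMap_X, ← map_pow, ← map_one (algebraMap ℚ[X] (RatFunc ℚ))]
  intro h
  have h1 := RatFunc.algebraMap_injective ℚ h
  have h2 := congrArg Polynomial.natDegree h1
  simp at h2
  omega

/-! ### Chebyshev values and the polynomials `h_p` -/

section Chebyshev

variable {R R' : Type*} [CommRing R] [CommRing R']

/-- The value at `t` of the rescaled Chebyshev polynomial `S_k`, `k ∈ ℤ`. For `t = y + y⁻¹` it is
`(y ^ (k + 1) - y ^ (-k - 1)) / (y - y⁻¹)`. -/
noncomputable def chebS (t : R) (k : ℤ) : R := (Polynomial.Chebyshev.S R k).eval t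

theorem chebS_zero (t : R) : chebS t 0 = 1 := by simp [chebS]

theorem chebS_neg_one (t : R) : chebS t (-1) = 0 := by simp [chebS]

theorem chebS_neg_two (t : R) : chebS t (-2) = -1 := by simp [chebS]

theorem chebS_add_two (t : R) (k : ℤ) : chebS t (k + 2) = t * chebS t (k + 1) - chebS t k := by
  simp [chebS, Polynomial.Chebyshev.S_add_two]

theorem chebS_eq (t : R) (k : ℤ) : chebS t k = t * chebS t (k - 1) - chebS t (k - 2) := by
  have := chebS_add_two t (k - 2)
  rw [show k - 2 + 2 = k by ring, show k - 2 + 1 = k - 1 by ring] at this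
  exact this

theorem map_chebS (f : R →+* R') (t : R) (k : ℤ) : f (chebS t k) = chebS (f t) k := by
  rw [chebS, chebS, ← Polynomial.Chebyshev.map_S f, Polynomial.eval_map, Polynomial.eval₂_hom]

/-- The quadratic relation between consecutive Chebyshev values: the determinant of the `k`-th
power of a matrix of trace `t` and determinant `1`. -/
theorem chebS_sq_add_sq (t : R) (k : ℤ) :
    chebS t k ^ 2 + chebS t (k - 1) ^ 2 - t * chebS t k * chebS t (k - 1) = 1 := by
  have h := congrArg (Polynomial.eval t) (Polynomial.Chebyshev.S_sq_add_S_sq R (k - 1))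
  simp only [sub_add_cancel, Polynomial.eval_sub, Polynomial.eval_add, Polynomial.eval_pow,
    Polynomial.eval_mul, Polynomial.eval_X, Polynomial.eval_one] at h
  rw [chebS, chebS]
  linear_combination h

theorem chebS_two (k : ℤ) : chebS (2 : R) k = k + 1 := by
  simp [chebS]

/-- The trace `y + y⁻¹` as a function of `M = m² + m⁻²` and `x`. -/
def twistTrace (M x : R) : R := M * (1 - x) + x ^ 2 + 1

/-- The polynomial `h_p` as a function of `M = m² + m⁻²` and `x`, in terms of the solutions of its
recursion that are given by Chebyshev polynomials. -/
noncomputable def twistH (M x : R) (p : ℤ) : R :=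
  chebS (twistTrace M x) (p - 1) * (M - x) - chebS (twistTrace M x) (p - 2)

theorem twistH_zero (M x : R) : twistH M x 0 = 1 := by
  simp [twistH, chebS_neg_one, chebS_neg_two]

theorem twistH_one (M x : R) : twistH M x 1 = M - x := by
  simp [twistH, chebS_neg_one, chebS_zero]

theorem twistH_eq (M x : R) (p : ℤ) :
    twistH M x p = twistTrace M x * twistH M x (p - 1) - twistH M x (p - 2) := by
  have h1 := chebS_eq (twistTrace M x) (p - 1)
  have h2 := chebS_eq (twistTrace M x) (p - 2)
  rw [show p - 1 - 2 = p - 2 - 1 by ring] at h1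
  rw [twistH, twistH, twistH, h1, h2, show p - 1 - 1 = p - 2 by ring,
    show p - 2 - 1 = p - 1 - 2 by ring]
  ring

theorem map_twistH (f : R →+* R') (M x : R) (p : ℤ) : f (twistH M x p) = twistH (f M) (f x) p := by
  simp [twistH, twistTrace, map_chebS]

/-- The factor `1 - x` turns `h_p` into a linear expression in `x` over the Chebyshev values
`S_p - S_{p-1}` and `S_{p-1} - S_{p-2}`. -/
theorem one_sub_mul_twistH (M x : R) (p : ℤ) :
    (1 - x) * twistH M x p =
      ((twistTrace M x - 1) * chebS (twistTrace M x) (p - 1) - chebS (twistTrace M x) (p - 2))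
        - x * (chebS (twistTrace M x) (p - 1) - chebS (twistTrace M x) (p - 2)) := by
  rw [twistH]
  generalize chebS (twistTrace M x) (p - 1) = S
  generalize chebS (twistTrace M x) (p - 2) = T
  rw [twistTrace]
  ring

end Chebyshev

section Laurent

open LaurentPolynomial Polynomial in
/-- The element `h_p` of `ℤ[m^{±1}, x]`. -/
noncomputable def laurentH (p : ℤ) : ℤ[T;T⁻¹][X] :=
  twistH (Polynomial.C (T 2 + T (-2))) Polynomial.X p

open LaurentPolynomial Polynomial in
theorem laurentH_one : laurentH 1 =
    Polynomial.C (T (-2)) * (Polynomial.C (T 4) - X * Polynomial.C (T 2) + 1) := by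
  have h2 : (Polynomial.C (T (-2)) * Polynomial.C (T 2) : ℤ[T;T⁻¹][X]) = 1 := by
    rw [← Polynomial.C_mul, ← T_add]; simp
  have h4 : (Polynomial.C (T (-2)) * Polynomial.C (T 4) : ℤ[T;T⁻¹][X]) = Polynomial.C (T 2) := by
    rw [← Polynomial.C_mul, ← T_add]; norm_num
  rw [laurentH, twistH_one, Polynomial.C_add]
  linear_combination -h4 + X * h2

open LaurentPolynomial Polynomial in
theorem laurentH_rec (p : ℤ) : laurentH p =
    Polynomial.C (T (-2)) * (Polynomial.C (T 4) - X * Polynomial.C (T 4)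
      + X ^ 2 * Polynomial.C (T 2) + Polynomial.C (T 2) + 1 - X) * laurentH (p - 1)
        - laurentH (p - 2) := by
  have h2 : (Polynomial.C (T (-2)) * Polynomial.C (T 2) : ℤ[T;T⁻¹][X]) = 1 := by
    rw [← Polynomial.C_mul, ← T_add]; simp
  have h4 : (Polynomial.C (T (-2)) * Polynomial.C (T 4) : ℤ[T;T⁻¹][X]) = Polynomial.C (T 2) := by
    rw [← Polynomial.C_mul, ← T_add]; norm_num
  rw [laurentH, twistH_eq, ← laurentH, ← laurentH, twistTrace, Polynomial.C_add]
  linear_combination (-(1 - X) * h4 - (X ^ 2 + 1) * h2) * laurentH (p - 1)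

theorem evalAt_laurentH {K : Type*} [Field K] (m : K) (hm : m ≠ 0) (x : K) (p : ℤ) :
    evalAt m hm x (laurentH p) = twistH (m ^ 2 + (m⁻¹) ^ 2) x p := by
  rw [evalAt, laurentH, ← Polynomial.coe_eval₂RingHom, map_twistH]
  congr 1
  · rw [Polynomial.coe_eval₂RingHom, Polynomial.eval₂_C, map_add, LaurentPolynomial.eval₂_T,
      LaurentPolynomial.eval₂_T]
    simp [zpow_ofNat, zpow_neg]
  · simp

end Laurent

/-! ### Consequences of the three equations -/

section Equations

variable {K : Type*} [Field K]

/-- If `y + y⁻¹` is the trace parameter of `h_p`, then `(y + 1) (1 - x) y ^ p h_p` is the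
expression `1 - x y + y ^ (2 p) (y - x)`. -/
theorem twistH_eq_of_trace {M x y : K} (hy : y ≠ 0) (h : y * twistTrace M x = y ^ 2 + 1) (p : ℤ) :
    (y + 1) * (1 - x) * y ^ p * twistH M x p = 1 - x * y + y ^ (2 * p) * (y - x) := by
  have hyp (p : ℤ) : y ^ (2 * p) = (y ^ p) ^ 2 := by rw [mul_comm, zpow_mul]; norm_cast
  have step (p : ℤ) : y * twistH M x p = (y ^ 2 + 1) * twistH M x (p - 1)
      - y * twistH M x (p - 2) := by
    rw [← h, twistH_eq]; ring
  -- the two statements for `p` and `p + 1` propagate in both directions along the recursion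
  suffices ((y + 1) * (1 - x) * y ^ p * twistH M x p = 1 - x * y + y ^ (2 * p) * (y - x)) ∧
      ((y + 1) * (1 - x) * y ^ (p + 1) * twistH M x (p + 1)
        = 1 - x * y + y ^ (2 * (p + 1)) * (y - x)) from this.1
  have h0 : twistH M x 0 = 1 := twistH_zero M x
  induction p using Int.induction_on with
  | zero =>
    refine ⟨by rw [h0]; simp; ring, ?_⟩
    rw [zero_add, twistH_one, hyp, zpow_one]
    rw [twistTrace] at h
    linear_combination (1 + y) * h
  | succ k ih =>
    refine ⟨ih.2, ?_⟩
    have hs := step (k + 1 + 1)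
    rw [show (k : ℤ) + 1 + 1 - 1 = k + 1 by ring, show (k : ℤ) + 1 + 1 - 2 = k by ring] at hs
    obtain ⟨h1, h2⟩ := ih
    simp only [hyp, zpow_add₀ hy, zpow_one] at *
    linear_combination (y + 1) * (1 - x) * y ^ (k : ℤ) * y * hs + (y ^ 2 + 1) * h2 - y ^ 2 * h1
  | pred k ih =>
    rw [show (-k : ℤ) - 1 + 1 = -k by ring]
    refine ⟨?_, ih.1⟩
    have hs := step (-k + 1)
    rw [show (-k : ℤ) + 1 - 1 = -k by ring, show (-k : ℤ) + 1 - 2 = -k - 1 by ring] at hs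
    obtain ⟨h1, h2⟩ := ih
    have hz : y ^ (-k : ℤ) = y ^ (-k - 1 : ℤ) * y := by
      rw [← zpow_add_one₀ hy]; congr 1; ring
    simp only [hyp, zpow_add₀ hy, zpow_one] at h1 h2 ⊢
    rw [hz] at h1 h2
    refine mul_left_cancel₀ (pow_ne_zero 2 hy) ?_
    linear_combination ((y + 1) * (1 - x) * y ^ (-k - 1 : ℤ) * y) * hs + (y ^ 2 + 1) * h1 - h2

variable {v : Fin 3 → K} {c : K}

/-- Evaluating a rational function that has a presentation `a / b` gives the equation
`c b = a` at every point where the function is defined with value `c`. -/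
theorem HasValueAt.mul_eq {g : RatQXY} (h : HasValueAt g v c) {a b : MvPolynomial (Fin 3) ℤ}
    (hb : b ≠ 0) (hg : g = algebraMap _ RatQXY a / algebraMap _ RatQXY b) :
    c * MvPolynomial.aeval v b = MvPolynomial.aeval v a := by
  obtain ⟨N, D, hND, hD, rfl⟩ := h
  have hD0 : D ≠ 0 := by rintro rfl; simp at hD
  have inj := IsFractionRing.injective (MvPolynomial (Fin 3) ℤ) RatQXY
  have e : N * b = a * D := by
    apply inj
    have hb' : algebraMap _ RatQXY b ≠ 0 := by rwa [Ne, map_eq_zero_iff _ inj]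
    have hD' : algebraMap _ RatQXY D ≠ 0 := by rwa [Ne, map_eq_zero_iff _ inj]
    rw [map_mul, map_mul, ← div_eq_div_iff hD' hb', ← hND, hg]
  rw [div_mul_eq_mul_div, div_eq_iff hD, ← map_mul, e, map_mul]

end Equations

section Equations

variable {K : Type*} [Field K]

open MvPolynomial in
theorem varQXY_eq (i : Fin 3) : varQXY i = algebraMap (MvPolynomial (Fin 3) ℤ) RatQXY (X i) := rfl

theorem varQXY_ne_zero (i : Fin 3) : varQXY i ≠ 0 := fun h =>
  MvPolynomial.X_ne_zero (R := ℤ) i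
    (IsFractionRing.injective (MvPolynomial (Fin 3) ℤ) RatQXY (h.trans (map_zero _).symm))

open MvPolynomial in
theorem ne_zero_of_eval_ne_zero {f : MvPolynomial (Fin 3) ℤ} (v : Fin 3 → ℤ)
    (hf : eval v f ≠ 0) : f ≠ 0 := by
  rintro rfl; simp at hf

theorem algebraMap_ne_zero_of_ne_zero {f : MvPolynomial (Fin 3) ℤ} (hf : f ≠ 0) :
    algebraMap (MvPolynomial (Fin 3) ℤ) RatQXY f ≠ 0 := by
  rwa [Ne, map_eq_zero_iff _ (IsFractionRing.injective (MvPolynomial (Fin 3) ℤ) RatQXY)]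

variable {m l x y : K}

open MvPolynomial in
theorem HasValueAt.eq_of_spec0 (h : HasValueAt spec0 ![m ^ 2, x, y] l) :
    x * (m ^ 2 + l) = l * m ^ 2 + 1 := by
  have hb : (X 0 - X 1 : MvPolynomial (Fin 3) ℤ) ≠ 0 :=
    ne_zero_of_eval_ne_zero ![0, 1, 0] (by simp)
  have hb1 : (X 0 - 1 : MvPolynomial (Fin 3) ℤ) ≠ 0 :=
    ne_zero_of_eval_ne_zero ![0, 1, 0] (by simp)
  have key := h.mul_eq (a := X 0 * X 1 - 1) hb (by
    have h0 := varQXY_ne_zero 0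
    have h1 := varQXY_ne_zero 1
    have h2 : varQXY 0 - varQXY 1 ≠ 0 := by
      simpa only [map_sub, map_mul, map_one, map_pow, ← varQXY_eq] using
        algebraMap_ne_zero_of_ne_zero hb
    have h3 : varQXY 0 - 1 ≠ 0 := by
      simpa only [map_sub, map_mul, map_one, map_pow, ← varQXY_eq] using
        algebraMap_ne_zero_of_ne_zero hb1
    simp only [map_sub, map_mul, map_one, ← varQXY_eq]
    rw [spec0, ratio0]
    generalize varQXY 0 = Q at *
    generalize varQXY 1 = X at *
    have e1 : 1 - Q⁻¹ = (Q - 1) / Q := by field_simp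
    have e2 : 1 - Q⁻¹ * X = (Q - X) / Q := by field_simp
    have e3 : 1 - Q⁻¹ * X⁻¹ = (Q * X - 1) / (Q * X) := by field_simp
    rw [inv_one, one_mul, e1, e2, e3]
    field_simp)
  simp at key
  linear_combination -key

open MvPolynomial in
theorem HasValueAt.eq_of_spec1 (h : HasValueAt spec1 ![m ^ 2, x, y] 1) :
    m ^ 2 * (1 - x * y) * (y - x) = -(m ^ 2 * x - 1) * (m ^ 2 - x) * (1 - x) * y := by
  have hb1 : (1 - X 1 * X 2 : MvPolynomial (Fin 3) ℤ) ≠ 0 :=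
    ne_zero_of_eval_ne_zero ![1, 0, 1] (by simp)
  have hb2 : (X 2 - X 1 : MvPolynomial (Fin 3) ℤ) ≠ 0 :=
    ne_zero_of_eval_ne_zero ![1, 0, 1] (by simp)
  have key := h.mul_eq (a := -(X 0 * X 1 - 1) * (X 0 - X 1) * (1 - X 1) * X 2)
    (mul_ne_zero (mul_ne_zero (X_ne_zero (0 : Fin 3)) hb1) hb2) (by
    have h0 := varQXY_ne_zero 0
    have h1 := varQXY_ne_zero 1
    have h2 := varQXY_ne_zero 2
    have h3 : 1 - varQXY 1 * varQXY 2 ≠ 0 := by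
      simpa only [map_sub, map_mul, map_one, map_pow, ← varQXY_eq] using
        algebraMap_ne_zero_of_ne_zero hb1
    have h4 : varQXY 2 - varQXY 1 ≠ 0 := by
      simpa only [map_sub, map_mul, map_one, map_pow, ← varQXY_eq] using
        algebraMap_ne_zero_of_ne_zero hb2
    simp only [map_sub, map_mul, map_neg, map_one, ← varQXY_eq]
    rw [spec1, ratio1]
    generalize varQXY 0 = Q at *
    generalize varQXY 1 = X at *
    generalize varQXY 2 = Y at *
    have e1 : 1 - X * Y⁻¹ = (Y - X) / Y := by field_simp
    have e2 : 1 - Q⁻¹ * X = (Q - X) / Q := by field_simp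
    have e3 : 1 - Q⁻¹ * X⁻¹ = (Q * X - 1) / (Q * X) := by field_simp
    rw [inv_one]
    simp only [one_mul, one_pow]
    rw [e1, e2, e3]
    field_simp)
  simp at key
  linear_combination key

open MvPolynomial in
theorem HasValueAt.eq_of_spec2 {p : ℤ} (hy : y ≠ 0) (h : HasValueAt (spec2 p) ![m ^ 2, x, y] 1) :
    1 - x * y = -y ^ (2 * p) * (y - x) := by
  have hb1 : (1 - X 1 * X 2 : MvPolynomial (Fin 3) ℤ) ≠ 0 :=
    ne_zero_of_eval_ne_zero ![1, 0, 1] (by simp)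
  have hb2 : (X 2 ^ 2 - 1 : MvPolynomial (Fin 3) ℤ) ≠ 0 :=
    ne_zero_of_eval_ne_zero ![1, 0, 0] (by simp)
  have h2 := varQXY_ne_zero 2
  have h3 : 1 - varQXY 1 * varQXY 2 ≠ 0 := by
    simpa only [map_sub, map_mul, map_one, map_pow, ← varQXY_eq] using
      algebraMap_ne_zero_of_ne_zero hb1
  have h4 : varQXY 2 ^ 2 - 1 ≠ 0 := by
    simpa only [map_sub, map_mul, map_one, map_pow, ← varQXY_eq] using
      algebraMap_ne_zero_of_ne_zero hb2
  have e : spec2 p = -varQXY 2 ^ (2 * p) * (varQXY 2 - varQXY 1)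
      / (1 - varQXY 1 * varQXY 2) := by
    rw [spec2, ratio2]
    generalize varQXY 1 = X at *
    generalize varQXY 2 = Y at *
    have e1 : 1 - X * Y⁻¹ = (Y - X) / Y := by field_simp
    simp only [one_zpow, one_pow, one_mul]
    rw [zpow_add_one₀ h2, e1]
    generalize Y ^ (2 * p) = Z
    field_simp
  obtain ⟨k, hk | hk⟩ := Int.eq_nat_or_neg p
  · have key := h.mul_eq (a := -X 2 ^ (2 * k) * (X 2 - X 1)) hb1 (by
      rw [e, hk]
      simp only [map_sub, map_mul, map_neg, map_one, map_pow, ← varQXY_eq]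
      norm_cast)
    simp at key
    rw [hk]
    norm_cast
    linear_combination key
  · have key := h.mul_eq (a := -(X 2 - X 1)) (b := X 2 ^ (2 * k) * (1 - X 1 * X 2))
      (mul_ne_zero (pow_ne_zero _ (X_ne_zero (2 : Fin 3))) hb1) (by
      rw [e, hk]
      simp only [map_sub, map_mul, map_neg, map_one, map_pow, ← varQXY_eq]
      rw [show 2 * (-k : ℤ) = -((2 * k : ℕ) : ℤ) by push_cast; ring, zpow_neg, zpow_natCast]
      field_simp)
    simp at key
    rw [hk, show 2 * (-k : ℤ) = -((2 * k : ℕ) : ℤ) by push_cast; ring, zpow_neg, zpow_natCast]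
    have := pow_ne_zero (2 * k) hy
    field_simp
    linear_combination key

/-- The consequence of the three equations: the second one says that `y + y⁻¹` is the trace
parameter of `h_p`, and the third one that the closed form of `h_p` vanishes. -/
theorem twistH_eq_zero_of_equations {p : ℤ} (hm : m ≠ 0) (hx : x ≠ 0) (hy : y ≠ 0)
    (h1 : m ^ 2 * (1 - x * y) * (y - x) = -(m ^ 2 * x - 1) * (m ^ 2 - x) * (1 - x) * y)
    (h2 : 1 - x * y = -y ^ (2 * p) * (y - x)) :
    (y + 1) * (1 - x) * y ^ p * twistH (m ^ 2 + (m⁻¹) ^ 2) x p = 0 := by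
  rw [twistH_eq_of_trace hy _ p]
  · linear_combination h2
  · have hi : m ^ 2 * m⁻¹ ^ 2 = 1 := by rw [← mul_pow, mul_inv_cancel₀ hm, one_pow]
    refine mul_left_cancel₀ (mul_ne_zero hx (pow_ne_zero 2 hm)) ?_
    rw [twistTrace]
    linear_combination h1 + x * y * (1 - x) * hi

end Equations

/-! ### Homomorphisms on knot groups as colourings of diagrams -/

section Colouring

variable {G : Type*} [Group G]

/-- A colouring of the arcs of `D` by elements of `G` that satisfies the Wirtinger relations. -/
def KnotDiagram.IsColouring (D : KnotDiagram) (c : Fin (D.n + 1) → G) : Prop :=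
  ∀ i, c (i + 1) =
    (c (D.overArc i) ^ ((D.sign i : ℤˣ) : ℤ))⁻¹ * c i * c (D.overArc i) ^ ((D.sign i : ℤˣ) : ℤ)

theorem KnotDiagram.isColouring_of_hom (D : KnotDiagram) (ρ : D.knotGroup →* G) :
    D.IsColouring fun i => ρ (PresentedGroup.of i) := by
  intro i
  have h : PresentedGroup.mk (Set.range D.relator) (D.relator i) = 1 :=
    PresentedGroup.one_of_mem ⟨i, rfl⟩
  have h' := congrArg ρ h
  rw [map_one, relator, map_mul, map_mul, map_mul, map_mul, map_mul, map_mul, map_inv, map_inv,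
    map_inv, map_inv, letter, map_zpow, map_zpow] at h'
  exact (mul_inv_eq_one.1 h').symm

theorem KnotDiagram.IsColouring.exists_hom {D : KnotDiagram} {c : Fin (D.n + 1) → G}
    (hc : D.IsColouring c) : ∃ ρ : D.knotGroup →* G, ∀ i, ρ (PresentedGroup.of i) = c i := by
  refine ⟨PresentedGroup.toGroup (f := c) ?_, fun i => PresentedGroup.toGroup.of _⟩
  rintro _ ⟨i, rfl⟩
  rw [relator, letter]
  simp only [map_mul, map_inv, map_zpow, FreeGroup.lift_apply_of]
  rw [hc i]
  group

theorem KnotDiagram.hom_longitude (D : KnotDiagram) (ρ : D.knotGroup →* G) :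
    ρ D.longitude = (List.ofFn fun i =>
        ρ (PresentedGroup.of (D.overArc i)) ^ ((D.sign i : ℤˣ) : ℤ)).prod
      * ρ (PresentedGroup.of 0) ^ (-D.writhe) := by
  rw [longitude, map_mul, map_zpow, meridian, map_list_prod, map_list_prod, List.map_ofFn,
    List.map_ofFn]
  congr 2
  refine congrArg List.ofFn (funext fun i => ?_)
  rw [Function.comp_apply, Function.comp_apply, letter, map_zpow, map_zpow]
  rfl

theorem list_prod_ofFn_two_mul_add_two (r : ℕ) (g : ℕ → G) :
    (List.ofFn fun i : Fin (2 * r + 1 + 1) => g i).prod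
      = ((List.range r).map g).prod * g r
        * ((List.range r).map fun j => g (r + 1 + j)).prod * g (2 * r + 1) := by
  have h : (List.ofFn fun i : Fin (2 * r + 1 + 1) => g i) = (List.range (2 * r + 1 + 1)).map g := by
    apply List.ext_getElem
    · simp
    · intro i h1 h2
      rw [List.getElem_ofFn, List.getElem_map, List.getElem_range]
  rw [h, List.range_succ, show 2 * r + 1 = r + 1 + r by ring, List.range_add, List.range_succ]
  simp [Function.comp_def, mul_assoc]

end Colouring

/-! ### The group of a twist knot -/

section TwistGroup

variable {G : Type*} [Group G]

/-- The conjugate `u ^ p * z * u ^ (-p)` with `u = a⁻¹ * b`. -/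
def twistConj (p : ℤ) (a b z : G) : G := (a⁻¹ * b) ^ p * z * (a⁻¹ * b) ^ (-p)

/-- The relation `w * b = a * w`, `w = u ^ p * b * u ^ (-p)`, `u = a⁻¹ * b`, that presents the group
of the twist knot `K_p` with the meridians `a`, `b` of the first and the last arc as generators. -/
def TwistRel (p : ℤ) (a b : G) : Prop := twistConj p a b b * b = a * twistConj p a b b

/-- The preferred longitude of `K_p` in terms of `a` and `b`. -/
def twistLongitude (p : ℤ) (a b : G) : G :=
  (twistConj (-p) a b a)⁻¹ * (twistConj p a b b)⁻¹ * a ^ 2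

theorem TwistRel.commute {p : ℤ} {a b : G} (h : TwistRel p a b) :
    Commute (twistLongitude p a b) a := by
  -- `w⁻¹` conjugates `a` to `b`, and the inverse of `u ^ (-p) * a * u ^ p` conjugates `b` to `a`
  have h1 : SemiconjBy (twistConj p a b b)⁻¹ a b := SemiconjBy.inv_symm_left h
  have h2 : SemiconjBy (twistConj (-p) a b a)⁻¹ b a := by
    apply SemiconjBy.inv_symm_left
    obtain ⟨u, rfl⟩ : ∃ u, b = a * u := ⟨a⁻¹ * b, by group⟩
    simp only [TwistRel, twistConj, inv_mul_cancel_left] at h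
    simp only [SemiconjBy, twistConj, inv_mul_cancel_left, neg_neg]
    calc u ^ (-p) * a * u ^ p * a
        = u ^ (-p) * (a * (u ^ p * (a * u) * u ^ (-p))) * (u⁻¹ * u ^ p) := by group
      _ = u ^ (-p) * (u ^ p * (a * u) * u ^ (-p) * (a * u)) * (u⁻¹ * u ^ p) := by rw [h]
      _ = a * u * (u ^ (-p) * a * u ^ p) := by group
  exact (h2.mul_left h1).mul_left ((Commute.refl a).pow_left 2)

/-- The word read along the diagram of `K_p`, for either sign of `p`, is the longitude. -/
theorem TwistRel.word_eq_longitude {p : ℤ} {a u : G} (h : TwistRel p a (a * u)) :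
    a ^ (-p) * u ^ (-p) * a⁻¹ * (u ^ p * (a * u) ^ (-p)) * (u ^ p * (a * u) * u ^ (-p))⁻¹
      * a ^ (2 * p + 2) = twistLongitude p a (a * u) := by
  have h1 : SemiconjBy (twistConj p a (a * u) (a * u))⁻¹ a (a * u) := SemiconjBy.inv_symm_left h
  have h2 := h.commute.zpow_right (-p)
  have h3 := h1.zpow_right (-p)
  rw [twistConj, inv_mul_cancel_left] at h3
  have e : a ^ (-p) * twistLongitude p a (a * u) * a ^ p = twistLongitude p a (a * u) := by
    rw [← h2.eq]; group
  rw [← e, twistLongitude, twistConj, twistConj, inv_mul_cancel_left, neg_neg]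
  calc _ = a ^ (-p) * u ^ (-p) * a⁻¹ * u ^ p * ((a * u) ^ (-p) * (u ^ p * (a * u) * u ^ (-p))⁻¹)
      * a ^ (2 * p + 2) := by group
    _ = a ^ (-p) * u ^ (-p) * a⁻¹ * u ^ p * ((u ^ p * (a * u) * u ^ (-p))⁻¹ * a ^ (-p))
      * a ^ (2 * p + 2) := by rw [h3.eq]
    _ = _ := by group

/-- The over-arc at the end of arc `k` in the diagram of `K_p`, as a function on `ℕ`. -/
def twistOver (p : ℤ) (k : ℕ) : ℕ :=
  if k = p.natAbs then 0
  else if k = 2 * p.natAbs + 1 then p.natAbs + 1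
  else if 0 ≤ p then 2 * p.natAbs - k
  else 2 * p.natAbs + 1 - k

/-- The sign of the crossing at the end of arc `k` in the diagram of `K_p`. -/
def twistSign (p : ℤ) (k : ℕ) : ℤ :=
  if k = p.natAbs ∨ k = 2 * p.natAbs + 1 ∨ 0 ≤ p then -1 else 1

theorem val_twistKnot_overArc (p : ℤ) (i : Fin (2 * p.natAbs + 1 + 1)) :
    ((twistKnot p).overArc i).val = twistOver p i := by
  simp only [twistKnot, twistOver]
  split_ifs <;> rfl

theorem twistKnot_sign (p : ℤ) (i : Fin (2 * p.natAbs + 1 + 1)) :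
    (((twistKnot p).sign i : ℤˣ) : ℤ) = twistSign p i := by
  simp only [twistKnot, twistSign]
  split_ifs <;> rfl

theorem twistKnot_writhe (p : ℤ) : (twistKnot p).writhe = -(2 * p + 2) := by
  have h : (twistKnot p).writhe = ∑ i : Fin (2 * p.natAbs + 1 + 1), twistSign p i :=
    Finset.sum_congr rfl fun i _ => twistKnot_sign p i
  rw [h, Fin.sum_univ_eq_sum_range, Finset.sum_range_succ,
    show 2 * p.natAbs + 1 = p.natAbs + 1 + p.natAbs by ring, Finset.sum_range_add,
    Finset.sum_range_succ]
  have e1 : ∑ x ∈ Finset.range p.natAbs, twistSign p x = -p := by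
    rw [Finset.sum_congr rfl (g := fun _ => if 0 ≤ p then -1 else 1)]
    · rw [Finset.sum_const, Finset.card_range]; split_ifs <;> simp <;> omega
    · intro x hx
      have := Finset.mem_range.1 hx
      simp only [twistSign]
      split_ifs <;> first | rfl | omega
  have e2 : ∑ x ∈ Finset.range p.natAbs, twistSign p (p.natAbs + 1 + x) = -p := by
    rw [Finset.sum_congr rfl (g := fun _ => if 0 ≤ p then -1 else 1)]
    · rw [Finset.sum_const, Finset.card_range]; split_ifs <;> simp <;> omega
    · intro x hx
      have := Finset.mem_range.1 hx
      simp only [twistSign]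
      split_ifs <;> first | rfl | omega
  rw [e1, e2]
  have e3 : twistSign p p.natAbs = -1 := by simp [twistSign]
  have e4 : twistSign p (p.natAbs + 1 + p.natAbs) = -1 := by
    rw [twistSign, if_pos]; right; left; ring
  rw [e3, e4]; ring

/-- The Wirtinger relation of `K_p` at the end of arc `k`, for a family indexed by `ℕ`. -/
def TwistWirtinger (p : ℤ) (X : ℕ → G) (k : ℕ) : Prop :=
  X (k + 1) = (X (twistOver p k) ^ twistSign p k)⁻¹ * X k * X (twistOver p k) ^ twistSign p k

theorem isColouring_twistKnot_iff {p : ℤ} {X : ℕ → G} (hX : X (2 * p.natAbs + 1 + 1) = X 0) :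
    (twistKnot p).IsColouring (fun i => X i.val) ↔
      ∀ k < 2 * p.natAbs + 1 + 1, TwistWirtinger p X k := by
  have hs (i : Fin (2 * p.natAbs + 1 + 1)) : X (i + 1).val = X (i.val + 1) := by
    rw [Fin.val_add_one]
    split_ifs with h
    · rw [h]; exact hX.symm
    · rfl
  have key (i : Fin (2 * p.natAbs + 1 + 1)) :
      (X (i + 1).val = (X ((twistKnot p).overArc i).val ^ (((twistKnot p).sign i : ℤˣ) : ℤ))⁻¹
        * X i.val * X ((twistKnot p).overArc i).val ^ (((twistKnot p).sign i : ℤˣ) : ℤ))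
      ↔ TwistWirtinger p X i.val := by
    rw [TwistWirtinger, hs, val_twistKnot_overArc, twistKnot_sign]
  exact ⟨fun h k hk => (key ⟨k, hk⟩).1 (h ⟨k, hk⟩), fun h i => (key i).2 (h i i.2)⟩

end TwistGroup

section TwistFamily

variable {G : Type*} [Group G]

/-- The exponent of `u` by which the twist region has conjugated its two strands after `i`
crossings. -/
def twistExp (p : ℤ) (i : ℕ) : ℤ := if 0 ≤ p then i else -i

theorem twistExp_natAbs (p : ℤ) : twistExp p p.natAbs = p := by
  rw [twistExp]; split_ifs <;> omega

/-- The shape of a colouring of the diagram of `K_p`: the two strands that enter the twist region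
with colours `a` and `a * u` are conjugated by powers of `u`. -/
def IsTwistFamily (p : ℤ) (a u : G) (X : ℕ → G) : Prop :=
  ∀ i ≤ p.natAbs, X i = u ^ twistExp p i * a * u ^ (-twistExp p i) ∧
    X (2 * p.natAbs + 1 - i) = u ^ twistExp p i * (a * u) * u ^ (-twistExp p i)

theorem IsTwistFamily.of_wirtinger {p : ℤ} {X : ℕ → G} {a u : G} (h0 : X 0 = a)
    (h1 : X (2 * p.natAbs + 1) = a * u)
    (h : ∀ k < 2 * p.natAbs + 1 + 1, TwistWirtinger p X k) : IsTwistFamily p a u X := by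
  intro i
  induction i with
  | zero => intro _; simp [twistExp, h0, h1]
  | succ i ih =>
    intro hi
    obtain ⟨ha, hb⟩ := ih (by omega)
    have k1 := h i (by omega)
    have k2 := h (2 * p.natAbs - i) (by omega)
    rw [TwistWirtinger] at k1 k2
    have o1 : ¬ i = p.natAbs := by omega
    have o2 : ¬ i = 2 * p.natAbs + 1 := by omega
    have o3 : ¬ 2 * p.natAbs - i = p.natAbs := by omega
    have o4 : ¬ 2 * p.natAbs - i = 2 * p.natAbs + 1 := by omega
    have o5 : 2 * p.natAbs - i + 1 = 2 * p.natAbs + 1 - i := by omega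
    have o6 : 2 * p.natAbs + 1 - (i + 1) = 2 * p.natAbs - i := by omega
    have o7 : 2 * p.natAbs - (2 * p.natAbs - i) = i := by omega
    have o8 : 2 * p.natAbs + 1 - (2 * p.natAbs - i) = i + 1 := by omega
    rw [o5] at k2
    rw [o6]
    simp only [twistOver, twistSign, o1, o2, o3, o4, o7, o8, if_false, false_or] at k1 k2
    by_cases hp : 0 ≤ p
    · simp only [hp, if_true, twistExp, zpow_neg_one, inv_inv] at *
      have k3 : X (2 * p.natAbs - i) = (X i)⁻¹ * X (2 * p.natAbs + 1 - i) * X i := by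
        rw [k2]; group
      rw [ha, hb] at k3
      have k4 : X (2 * p.natAbs - i)
          = u ^ ((i + 1 : ℕ) : ℤ) * (a * u) * u ^ (-((i + 1 : ℕ) : ℤ)) := by
        rw [k3]; push_cast; group
      refine ⟨?_, k4⟩
      rw [k1, k4, ha]; push_cast; group
    · simp only [hp, if_false, twistExp, zpow_one] at *
      rw [ha, hb] at k1
      have k4 : X (i + 1) = u ^ (-((i + 1 : ℕ) : ℤ)) * a * u ^ (- -((i + 1 : ℕ) : ℤ)) := by
        rw [k1]; push_cast; group
      refine ⟨k4, ?_⟩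
      have k3 : X (2 * p.natAbs - i) = X (i + 1) * X (2 * p.natAbs + 1 - i) * (X (i + 1))⁻¹ := by
        rw [k2]; group
      rw [k3, k4, hb]; push_cast; group

theorem IsTwistFamily.rel {p : ℤ} {X : ℕ → G} {a u : G} (hX : IsTwistFamily p a u X)
    (hc : X (2 * p.natAbs + 1 + 1) = X 0)
    (h : TwistWirtinger p X (2 * p.natAbs + 1)) : TwistRel p a (a * u) := by
  have h0 := (hX 0 (Nat.zero_le _)).1
  have h1 := (hX 0 (Nat.zero_le _)).2
  have h2 := (hX p.natAbs le_rfl).2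
  rw [twistExp_natAbs, show 2 * p.natAbs + 1 - p.natAbs = p.natAbs + 1 by omega] at h2
  have e0 : twistExp p 0 = 0 := by simp [twistExp]
  rw [e0] at h0 h1
  rw [TwistWirtinger, hc] at h
  have o1 : ¬ 2 * p.natAbs + 1 = p.natAbs := by omega
  simp only [twistOver, twistSign, o1, if_false, if_true, false_or, true_or, zpow_neg_one, inv_inv,
    h2] at h
  simp only [zpow_zero, neg_zero, one_mul, mul_one, Nat.sub_zero] at h0 h1
  rw [h0, h1] at h
  rw [TwistRel, twistConj, inv_mul_cancel_left]
  exact (eq_mul_inv_iff_mul_eq.1 h).symm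

theorem IsTwistFamily.wirtinger {p : ℤ} {X : ℕ → G} {a u : G} (hX : IsTwistFamily p a u X)
    (hc : X (2 * p.natAbs + 1 + 1) = X 0) (hr : TwistRel p a (a * u)) :
    ∀ k < 2 * p.natAbs + 1 + 1, TwistWirtinger p X k := by
  intro k hk
  have h0 := (hX 0 (Nat.zero_le _)).1
  have h1 := (hX 0 (Nat.zero_le _)).2
  have h2 := (hX p.natAbs le_rfl).2
  have h3 := (hX p.natAbs le_rfl).1
  rw [twistExp_natAbs] at h2 h3
  rw [show 2 * p.natAbs + 1 - p.natAbs = p.natAbs + 1 by omega] at h2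
  have e0 : twistExp p 0 = 0 := by simp [twistExp]
  rw [e0] at h0 h1
  simp only [zpow_zero, neg_zero, one_mul, mul_one, Nat.sub_zero] at h0 h1
  rw [TwistRel, twistConj, inv_mul_cancel_left] at hr
  rw [TwistWirtinger]
  obtain hk1 | hk1 | hk1 | hk1 : k < p.natAbs ∨ k = p.natAbs ∨
      (p.natAbs < k ∧ k < 2 * p.natAbs + 1) ∨ k = 2 * p.natAbs + 1 := by omega
  · have o1 : ¬ k = p.natAbs := by omega
    have o2 : ¬ k = 2 * p.natAbs + 1 := by omega
    obtain ⟨ha, hb⟩ := hX k hk1.le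
    obtain ⟨ha', hb'⟩ := hX (k + 1) hk1
    rw [show 2 * p.natAbs + 1 - (k + 1) = 2 * p.natAbs - k by omega] at hb'
    simp only [twistOver, twistSign, o1, o2, if_false, false_or]
    by_cases hp : 0 ≤ p
    · simp only [hp, if_true, twistExp, zpow_neg_one, inv_inv] at *
      rw [ha, ha', hb']; push_cast; group
    · simp only [hp, if_false, twistExp, zpow_one] at *
      rw [ha, ha', hb]; push_cast; group
  · subst hk1
    simp only [twistOver, twistSign, if_true, true_or, zpow_neg_one, inv_inv]
    rw [h0, h2, h3]
    calc u ^ p * (a * u) * u ^ (-p)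
        = u ^ p * (a * u) * u ^ (-p) * (a * u) * u⁻¹ * a⁻¹ := by group
      _ = a * (u ^ p * (a * u) * u ^ (-p)) * u⁻¹ * a⁻¹ := by rw [hr]
      _ = a * (u ^ p * a * u ^ (-p)) * a⁻¹ := by group
  · obtain ⟨i, hi, rfl⟩ : ∃ i < p.natAbs, k = 2 * p.natAbs - i :=
      ⟨2 * p.natAbs - k, by omega, by omega⟩
    have o1 : ¬ 2 * p.natAbs - i = p.natAbs := by omega
    have o2 : ¬ 2 * p.natAbs - i = 2 * p.natAbs + 1 := by omega
    have o3 : 2 * p.natAbs - (2 * p.natAbs - i) = i := by omega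
    have o4 : 2 * p.natAbs + 1 - (2 * p.natAbs - i) = i + 1 := by omega
    have o5 : 2 * p.natAbs - i + 1 = 2 * p.natAbs + 1 - i := by omega
    obtain ⟨ha, hb⟩ := hX i hi.le
    obtain ⟨ha', hb'⟩ := hX (i + 1) hi
    rw [show 2 * p.natAbs + 1 - (i + 1) = 2 * p.natAbs - i by omega] at hb'
    simp only [twistOver, twistSign, o1, o2, o3, o4, o5, if_false, false_or]
    by_cases hp : 0 ≤ p
    · simp only [hp, if_true, twistExp, zpow_neg_one, inv_inv] at *
      rw [ha, hb, hb']; push_cast; group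
    · simp only [hp, if_false, twistExp, zpow_one] at *
      rw [ha', hb, hb']; push_cast; group
  · subst hk1
    have o1 : ¬ 2 * p.natAbs + 1 = p.natAbs := by omega
    simp only [twistOver, twistSign, o1, if_false, if_true, false_or, true_or, zpow_neg_one,
      inv_inv]
    rw [hc, h0, h1, h2]
    exact eq_mul_inv_iff_mul_eq.2 hr.symm

/-- The letters read along the diagram of `K_p`, before the correction by the writhe. -/
theorem IsTwistFamily.prod_letters {p : ℤ} {X : ℕ → G} {a u : G} (hX : IsTwistFamily p a u X) :
    (List.ofFn fun i : Fin (2 * p.natAbs + 1 + 1) => X (twistOver p i) ^ twistSign p i).prod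
      = a ^ (-p) * u ^ (-p) * a⁻¹ * (u ^ p * (a * u) ^ (-p))
        * (u ^ p * (a * u) * u ^ (-p))⁻¹ := by
  rw [list_prod_ofFn_two_mul_add_two p.natAbs fun k => X (twistOver p k) ^ twistSign p k]
  have h0 := (hX 0 (Nat.zero_le _)).1
  have h2 := (hX p.natAbs le_rfl).2
  rw [twistExp_natAbs, show 2 * p.natAbs + 1 - p.natAbs = p.natAbs + 1 by omega] at h2
  have e0 : twistExp p 0 = 0 := by simp [twistExp]
  rw [e0, zpow_zero, neg_zero, zpow_zero, one_mul, mul_one] at h0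
  have o1 : ¬ 2 * p.natAbs + 1 = p.natAbs := by omega
  have l1 : X (twistOver p p.natAbs) ^ twistSign p p.natAbs = a⁻¹ := by
    simp [twistOver, twistSign, h0]
  have l2 : X (twistOver p (2 * p.natAbs + 1)) ^ twistSign p (2 * p.natAbs + 1)
      = (u ^ p * (a * u) * u ^ (-p))⁻¹ := by
    simp only [twistOver, twistSign, o1, if_false, if_true, false_or, true_or, zpow_neg_one, h2]
  -- the first passage of the twist region
  have l3 : ∀ k ≤ p.natAbs,
      ((List.range k).map fun i => X (twistOver p i) ^ twistSign p i).prod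
        = a ^ (-twistExp p k) * u ^ (-twistExp p k) := by
    intro k
    induction k with
    | zero => simp [twistExp]
    | succ k ih =>
      intro hk
      have o1 : ¬ k = p.natAbs := by omega
      have o2 : ¬ k = 2 * p.natAbs + 1 := by omega
      have hb := (hX k (by omega)).2
      have hb' := (hX (k + 1) hk).2
      rw [show 2 * p.natAbs + 1 - (k + 1) = 2 * p.natAbs - k by omega] at hb'
      rw [List.range_succ, List.map_append, List.prod_append, ih (by omega)]
      simp only [List.map_cons, List.map_nil, List.prod_singleton, twistOver, twistSign, o1, o2,
        if_false, false_or]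
      by_cases hp : 0 ≤ p
      · simp only [hp, if_true, twistExp, zpow_neg_one] at *
        rw [hb']; push_cast; group
      · simp only [hp, if_false, twistExp, zpow_one] at *
        rw [hb]; push_cast; group
  -- the second passage of the twist region, in the opposite direction
  have l4 : ∀ k ≤ p.natAbs,
      ((List.range k).map fun j =>
        X (twistOver p (p.natAbs + 1 + j)) ^ twistSign p (p.natAbs + 1 + j)).prod
        = u ^ p * (a * u) ^ (-twistExp p k) * u ^ (twistExp p k - p) := by
    intro k
    induction k with
    | zero => simp [twistExp]
    | succ k ih =>
      intro hk
      have o1 : ¬ p.natAbs + 1 + k = p.natAbs := by omega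
      have o2 : ¬ p.natAbs + 1 + k = 2 * p.natAbs + 1 := by omega
      have ha := (hX (p.natAbs - k) (by omega)).1
      have ha' := (hX (p.natAbs - (k + 1)) (by omega)).1
      rw [List.range_succ, List.map_append, List.prod_append, ih (by omega)]
      simp only [List.map_cons, List.map_nil, List.prod_singleton, twistOver, twistSign, o1, o2,
        if_false, false_or]
      rw [show 2 * p.natAbs - (p.natAbs + 1 + k) = p.natAbs - (k + 1) by omega,
        show 2 * p.natAbs + 1 - (p.natAbs + 1 + k) = p.natAbs - k by omega]
      by_cases hp : 0 ≤ p
      · have hn : ((p.natAbs - (k + 1) : ℕ) : ℤ) = p - k - 1 := by omega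
        have hs : -((k + 1 : ℕ) : ℤ) = -k - 1 := by push_cast; ring
        simp only [hp, if_true, twistExp, zpow_neg_one] at *
        rw [ha', hn, hs, zpow_sub_one (a * u), mul_inv_rev]
        generalize (a * u) ^ (-(k : ℤ)) = g
        push_cast; group
      · have hn : ((p.natAbs - k : ℕ) : ℤ) = -p - k := by omega
        have hs : - -((k + 1 : ℕ) : ℤ) = k + 1 := by push_cast; ring
        simp only [hp, if_false, twistExp, zpow_one] at *
        rw [ha, hn, hs, zpow_add_one (a * u)]
        push_cast; group
  rw [l1, l2, l3 _ le_rfl, l4 _ le_rfl, twistExp_natAbs, sub_self, zpow_zero, mul_one]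

/-- The homomorphisms from the group of `K_p`, by their values on meridian and longitude. -/
theorem exists_hom_twistKnot_iff {p : ℤ} {z w : G} :
    (∃ ρ : (twistKnot p).knotGroup →* G,
        ρ (twistKnot p).meridian = z ∧ ρ (twistKnot p).longitude = w) ↔
      ∃ b, TwistRel p z b ∧ w = twistLongitude p z b := by
  have hlong (ρ : (twistKnot p).knotGroup →* G) (X : ℕ → G)
      (hρ : ∀ i : Fin (2 * p.natAbs + 1 + 1), ρ (PresentedGroup.of i) = X i) (a u : G)
      (hX : IsTwistFamily p a u X) (hr : TwistRel p a (a * u)) :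
      ρ (twistKnot p).longitude = twistLongitude p a (a * u) := by
    have h0 := (hX 0 (Nat.zero_le _)).1
    have e0 : twistExp p 0 = 0 := by simp [twistExp]
    rw [e0, zpow_zero, neg_zero, zpow_zero, one_mul, mul_one] at h0
    have hρ0 : ρ (PresentedGroup.of 0) = a := (hρ 0).trans h0
    rw [KnotDiagram.hom_longitude, twistKnot_writhe, neg_neg, hρ0, ← hr.word_eq_longitude,
      ← hX.prod_letters]
    congr 2
    refine congrArg List.ofFn (funext fun i => ?_)
    exact (congrArg₂ (fun (g : G) (s : ℤ) => g ^ s) (hρ _) (twistKnot_sign p i)).trans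
      (congrArg (fun j => X j ^ twistSign p i) (val_twistKnot_overArc p i))
  constructor
  · rintro ⟨ρ, rfl, rfl⟩
    let X : ℕ → G := fun k => ρ (PresentedGroup.of (Fin.ofNat (2 * p.natAbs + 1 + 1) k))
    have hρ (i : Fin (2 * p.natAbs + 1 + 1)) : ρ (PresentedGroup.of i) = X i := by
      simp only [X, Fin.ofNat_val_eq_self]
    have hc : X (2 * p.natAbs + 1 + 1) = X 0 := by
      change ρ _ = ρ _
      congr 2
      ext
      simp
    have hcol := (twistKnot p).isColouring_of_hom ρ
    have hcol' : (twistKnot p).IsColouring (fun i => X i.val) := by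
      convert hcol using 2 with i
      exact (hρ i).symm
    have hW := (isColouring_twistKnot_iff hc).1 hcol'
    have hX : IsTwistFamily p (X 0) ((X 0)⁻¹ * X (2 * p.natAbs + 1)) X :=
      IsTwistFamily.of_wirtinger rfl (by group) hW
    have hr := hX.rel hc (hW _ (by omega))
    exact ⟨_, hr, hlong ρ X hρ _ _ hX hr⟩
  · rintro ⟨b, hr, rfl⟩
    obtain ⟨u, rfl⟩ : ∃ u, b = z * u := ⟨z⁻¹ * b, by group⟩
    let X : ℕ → G := fun k =>
      if k ≤ p.natAbs then u ^ twistExp p k * z * u ^ (-twistExp p k)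
      else if k ≤ 2 * p.natAbs + 1 then
        u ^ twistExp p (2 * p.natAbs + 1 - k) * (z * u) * u ^ (-twistExp p (2 * p.natAbs + 1 - k))
      else z
    have hX : IsTwistFamily p z u X := by
      intro i hi
      have o1 : ¬ 2 * p.natAbs + 1 - i ≤ p.natAbs := by omega
      have o2 : 2 * p.natAbs + 1 - i ≤ 2 * p.natAbs + 1 := by omega
      have o3 : 2 * p.natAbs + 1 - (2 * p.natAbs + 1 - i) = i := by omega
      simp only [X, if_pos hi, if_neg o1, if_pos o2, o3, and_self]
    have h0 : X 0 = z := by simp [X, twistExp]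
    have hc : X (2 * p.natAbs + 1 + 1) = X 0 := by
      have o1 : ¬ 2 * p.natAbs + 1 + 1 ≤ p.natAbs := by omega
      have o2 : ¬ 2 * p.natAbs + 1 + 1 ≤ 2 * p.natAbs + 1 := by omega
      rw [h0]
      simp only [X, if_neg o1, if_neg o2]
    obtain ⟨ρ, hρ⟩ := ((isColouring_twistKnot_iff hc).2 (hX.wirtinger hc hr)).exists_hom
    exact ⟨ρ, (hρ 0).trans h0, hlong ρ X hρ _ _ hX hr⟩

end TwistFamily

/-! ### Representations of twist knot groups in `SL₂` -/

section Hom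

variable {G H : Type*} [Group G] [Group H]

theorem map_twistConj (f : G →* H) (p : ℤ) (a b z : G) :
    f (twistConj p a b z) = twistConj p (f a) (f b) (f z) := by
  simp [twistConj]

theorem map_twistLongitude (f : G →* H) (p : ℤ) (a b : G) :
    f (twistLongitude p a b) = twistLongitude p (f a) (f b) := by
  simp only [twistLongitude, map_mul, map_inv, map_pow, map_twistConj]

theorem TwistRel.map {p : ℤ} {a b : G} (h : TwistRel p a b) (f : G →* H) :
    TwistRel p (f a) (f b) := by
  rw [TwistRel, ← map_twistConj, ← map_mul, ← map_mul]
  exact congrArg f h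

end Hom

section SL2

variable {K : Type*} [Field K]

theorem SL2_inv_apply (x : SL(2, K)) :
    x⁻¹ 0 0 = x 1 1 ∧ x⁻¹ 0 1 = -x 0 1 ∧ x⁻¹ 1 0 = -x 1 0 ∧ x⁻¹ 1 1 = x 0 0 := by
  have h (i j) : x⁻¹ i j = Matrix.adjugate (x : Matrix (Fin 2) (Fin 2) K) i j :=
    congrFun (congrFun (Matrix.SpecialLinearGroup.coe_inv x) i) j
  simp [h, Matrix.adjugate_fin_two]

theorem SL2_mul_apply (x y : SL(2, K)) (i j : Fin 2) :
    (x * y) i j = x i 0 * y 0 j + x i 1 * y 1 j := by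
  have h : (x * y) i j = ((x : Matrix (Fin 2) (Fin 2) K) * (y : Matrix (Fin 2) (Fin 2) K)) i j :=
    congrFun (congrFun (Matrix.SpecialLinearGroup.coe_mul x y) i) j
  rw [h, Matrix.mul_apply, Fin.sum_univ_two]

theorem SL2_det (x : SL(2, K)) : x 0 0 * x 1 1 - x 0 1 * x 1 0 = 1 := by
  have h := x.det_coe
  rwa [Matrix.det_fin_two] at h

/-- Powers in `SL₂` by the Cayley–Hamilton theorem. -/
theorem SL2_zpow (u : SL(2, K)) (k : ℤ) (i j : Fin 2) :
    (u ^ k) i j = chebS (u 0 0 + u 1 1) (k - 1) * u i j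
      - chebS (u 0 0 + u 1 1) (k - 2) * (1 : Matrix (Fin 2) (Fin 2) K) i j := by
  have hd := SL2_det u
  induction k using Int.induction_on generalizing i j with
  | zero => simp [chebS_neg_one, chebS_neg_two]
  | succ k ih =>
    have h := chebS_eq (u 0 0 + u 1 1) (k + 1 - 1)
    rw [zpow_add_one, SL2_mul_apply, ih, ih, h, show (k : ℤ) + 1 - 1 - 1 = k - 1 by ring,
      show (k : ℤ) + 1 - 1 - 2 = k - 1 - 1 by ring, show (k : ℤ) - 1 - 1 = k - 2 by ring,
      show (k : ℤ) + 1 - 2 = k - 1 by ring]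
    generalize chebS (u 0 0 + u 1 1) (k - 1) = S
    generalize chebS (u 0 0 + u 1 1) (k - 2) = T
    fin_cases i <;> fin_cases j <;> simp [Matrix.one_apply]
    · linear_combination -S * hd
    · ring
    · ring
    · linear_combination -S * hd
  | pred k ih =>
    have h := chebS_eq (u 0 0 + u 1 1) (-k - 1)
    obtain ⟨h1, h2, h3, h4⟩ := SL2_inv_apply u
    rw [zpow_sub_one, SL2_mul_apply, ih, ih, h, show (-k : ℤ) - 1 - 1 = -k - 2 by ring,
      show (-k : ℤ) - 1 - 2 = -k - 3 by ring]
    rw [show (-k : ℤ) - 1 - 1 = -k - 2 by ring, show (-k : ℤ) - 1 - 2 = -k - 3 by ring] at h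
    generalize chebS (u 0 0 + u 1 1) (-k - 2) = T
    generalize chebS (u 0 0 + u 1 1) (-k - 3) = T'
    fin_cases i <;> fin_cases j <;> simp [Matrix.one_apply, h1, h2, h3, h4]
    · linear_combination ((u 0 0 + u 1 1) * T - T') * hd
    · ring
    · ring
    · linear_combination ((u 0 0 + u 1 1) * T - T') * hd

/-- Conjugation by an upper triangular matrix does not change the diagonal of an upper triangular
matrix. -/
theorem twistConj_apply_of_upper {p : ℤ} {a b z : SL(2, K)} (ha : a 1 0 = 0) (hb : b 1 0 = 0)
    (hz : z 1 0 = 0) : twistConj p a b z 0 0 = z 0 0 ∧ twistConj p a b z 1 0 = 0 := by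
  obtain ⟨h1, h2, h3, h4⟩ := SL2_inv_apply a
  have hu : (a⁻¹ * b) 1 0 = 0 := by rw [SL2_mul_apply, h3, ha, hb]; ring
  have hup (k : ℤ) : ((a⁻¹ * b) ^ k) 1 0 = 0 := by rw [SL2_zpow, hu]; simp
  have hinv : ((a⁻¹ * b) ^ p) 0 0 * ((a⁻¹ * b) ^ (-p)) 0 0 = 1 := by
    have h := SL2_mul_apply ((a⁻¹ * b) ^ p) ((a⁻¹ * b) ^ (-p)) 0 0
    rw [← zpow_add, add_neg_cancel, zpow_zero, hup (-p)] at h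
    simpa using h.symm
  rw [twistConj, SL2_mul_apply, SL2_mul_apply, SL2_mul_apply, SL2_mul_apply, SL2_mul_apply, hup,
    hup, hz]
  exact ⟨by linear_combination z 0 0 * hinv, by ring⟩

/-- A representation by upper triangular matrices takes the longitude to a unipotent matrix. -/
theorem twistLongitude_apply_of_upper {p : ℤ} {a b : SL(2, K)} (h : TwistRel p a b)
    (ha : a 1 0 = 0) (hb : b 1 0 = 0) : twistLongitude p a b 0 0 = 1 := by
  obtain ⟨hw, hw'⟩ := twistConj_apply_of_upper (p := p) ha hb hb
  obtain ⟨hx, hx'⟩ := twistConj_apply_of_upper (p := -p) ha hb ha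
  have hda := SL2_det a
  have hdb := SL2_det b
  have hdw := SL2_det (twistConj p a b b)
  have hdx := SL2_det (twistConj (-p) a b a)
  obtain ⟨i1, i2, i3, i4⟩ := SL2_inv_apply (twistConj p a b b)
  obtain ⟨j1, j2, j3, j4⟩ := SL2_inv_apply (twistConj (-p) a b a)
  have hab : b 0 0 = a 0 0 := by
    have h00 := congrArg (fun x : SL(2, K) => x 0 0) h
    simp only [SL2_mul_apply, hw, hw', hb] at h00
    have hb0 : b 0 0 ≠ 0 := by
      intro h0
      rw [h0, hb] at hdb
      simp at hdb
    exact mul_right_cancel₀ hb0 (by linear_combination h00)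
  rw [hw', hw, hab] at hdw
  rw [hx', hx] at hdx
  simp only [twistLongitude, pow_two a, SL2_mul_apply, i1, i3, j1, j2, hw', ha]
  linear_combination a 0 0 * twistConj p a b b 1 1 * hdx + hdw

theorem twistLongitude_apply_of_lower {p : ℤ} {a b : SL(2, K)} (h : TwistRel p a b)
    (ha : a 0 1 = 0) (hb : b 0 1 = 0) (hl : twistLongitude p a b 1 0 = 0) :
    twistLongitude p a b 0 0 = 1 := by
  -- the Weyl element exchanges lower and upper triangular matrices
  let J : SL(2, K) := ⟨!![0, 1; -1, 0], by simp [Matrix.det_fin_two]⟩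
  have J0 : J 0 0 = 0 ∧ J 0 1 = 1 ∧ J 1 0 = -1 ∧ J 1 1 = 0 := by simp [J]
  obtain ⟨J1, J2, J3, J4⟩ := J0
  obtain ⟨i1, i2, i3, i4⟩ := SL2_inv_apply J
  have hJ (x : SL(2, K)) : MulAut.conj J x 0 0 = x 1 1 ∧ MulAut.conj J x 1 0 = -x 0 1 := by
    rw [MulAut.conj_apply]
    simp [SL2_mul_apply, i1, i3, J1, J2, J3, J4]
  have h1 := twistLongitude_apply_of_upper (h.map (MulAut.conj J).toMonoidHom)
    ((hJ a).2.trans (by rw [ha, neg_zero])) ((hJ b).2.trans (by rw [hb, neg_zero]))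
  rw [← map_twistLongitude] at h1
  have h2 : twistLongitude p a b 1 1 = 1 := (hJ _).1.symm.trans h1
  have h3 := SL2_det (twistLongitude p a b)
  rw [h2, hl] at h3
  linear_combination h3

end SL2

section Normalized

variable {K : Type*} [Field K]

/-- A pair of matrices in the normal form of an irreducible representation: `a` is upper
triangular, `b` is lower triangular, and both have the diagonal `m, m⁻¹`. -/
structure IsRileyPair (m n c d : K) (a b : SL(2, K)) : Prop where
  mul_eq_one : m * n = 1
  a00 : a 0 0 = m
  a01 : a 0 1 = d
  a10 : a 1 0 = 0
  a11 : a 1 1 = n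
  b00 : b 0 0 = m
  b01 : b 0 1 = 0
  b10 : b 1 0 = c
  b11 : b 1 1 = n

/-- The Riley polynomial of `K_p`, as a function of `M = m² + m⁻²` and of the trace `t` of
`a⁻¹ * b`. -/
noncomputable def rileyPoly (p : ℤ) (M t : K) : K :=
  (t - M) * (chebS t (p - 1) - chebS t (p - 2)) * chebS t (p - 1) - 1

variable {m n c d : K} {a b : SL(2, K)} (h : IsRileyPair m n c d a b)
include h

theorem IsRileyPair.zpow_apply (p : ℤ) :
    ((a⁻¹ * b) ^ p) 0 0 = chebS (2 - c * d) (p - 1) * (1 - c * d) - chebS (2 - c * d) (p - 2) ∧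
    ((a⁻¹ * b) ^ p) 0 1 = -chebS (2 - c * d) (p - 1) * d * n ∧
    ((a⁻¹ * b) ^ p) 1 0 = chebS (2 - c * d) (p - 1) * m * c ∧
    ((a⁻¹ * b) ^ p) 1 1 = chebS (2 - c * d) (p - 1) - chebS (2 - c * d) (p - 2) := by
  obtain ⟨i1, i2, i3, i4⟩ := SL2_inv_apply a
  have u00 : (a⁻¹ * b) 0 0 = 1 - c * d := by
    rw [SL2_mul_apply, i1, i2, h.a11, h.a01, h.b00, h.b10]; linear_combination h.mul_eq_one
  have u01 : (a⁻¹ * b) 0 1 = -d * n := by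
    rw [SL2_mul_apply, i1, i2, h.a11, h.a01, h.b01, h.b11]; ring
  have u10 : (a⁻¹ * b) 1 0 = m * c := by
    rw [SL2_mul_apply, i3, i4, h.a10, h.a00, h.b00, h.b10]; ring
  have u11 : (a⁻¹ * b) 1 1 = 1 := by
    rw [SL2_mul_apply, i3, i4, h.a10, h.a00, h.b01, h.b11]; linear_combination h.mul_eq_one
  have ht : (a⁻¹ * b) 0 0 + (a⁻¹ * b) 1 1 = 2 - c * d := by rw [u00, u11]; ring
  refine ⟨?_, ?_, ?_, ?_⟩ <;> rw [SL2_zpow, ht] <;> simp only [u00, u01, u10, u11] <;> simp <;> ring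

theorem IsRileyPair.twistConj_b (p : ℤ) :
    twistConj p a b b 0 0 = m - m * c * d * chebS (2 - c * d) (p - 1) ^ 2
      + n * c * d * chebS (2 - c * d) (p - 1) * chebS (2 - c * d) (p - 2) ∧
    twistConj p a b b 0 1 = d * ((1 - n ^ 2) * chebS (2 - c * d) (p - 1)
        * (chebS (2 - c * d) (p - 1) - chebS (2 - c * d) (p - 2))
      - c * d * chebS (2 - c * d) (p - 1) ^ 2) ∧
    twistConj p a b b 1 0 = c * ((m ^ 2 - 1) * chebS (2 - c * d) (p - 1)
        * (chebS (2 - c * d) (p - 1) - chebS (2 - c * d) (p - 2))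
      - c * d * chebS (2 - c * d) (p - 1) * chebS (2 - c * d) (p - 2) + 1) ∧
    twistConj p a b b 1 1 = n + m * c * d * chebS (2 - c * d) (p - 1) ^ 2
      - n * c * d * chebS (2 - c * d) (p - 1) * chebS (2 - c * d) (p - 2) := by
  obtain ⟨u00, u01, u10, u11⟩ := h.zpow_apply p
  obtain ⟨i00, i01, i10, i11⟩ := SL2_inv_apply ((a⁻¹ * b) ^ p)
  have hS := chebS_sq_add_sq (2 - c * d) (p - 1)
  rw [show p - 1 - 1 = p - 2 by ring] at hS
  have hm := h.mul_eq_one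
  simp only [twistConj, SL2_mul_apply, zpow_neg, i00, i01, i10, i11, u00, u01, u10, u11, h.b00,
    h.b01, h.b10, h.b11]
  generalize chebS (2 - c * d) (p - 1) = S at *
  generalize chebS (2 - c * d) (p - 2) = T at *
  refine ⟨?_, ?_, ?_, ?_⟩
  · linear_combination n * c * d * S ^ 2 * hm + m * hS
  · linear_combination (-c * d ^ 2 * S ^ 2 + d * S ^ 2 - d * S * T) * hm
  · linear_combination (-c * S ^ 2 + c * S * T) * hm + c * hS
  · linear_combination m * c * d * S ^ 2 * hm + n * hS

theorem IsRileyPair.twistConj_a (p : ℤ) :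
    twistConj (-p) a b a 1 0 = c * chebS (2 - c * d) (p - 1) *
      ((1 - m ^ 2) * (chebS (2 - c * d) (p - 1) - chebS (2 - c * d) (p - 2))
        - c * d * chebS (2 - c * d) (p - 1)) := by
  obtain ⟨u00, u01, u10, u11⟩ := h.zpow_apply p
  obtain ⟨i00, i01, i10, i11⟩ := SL2_inv_apply ((a⁻¹ * b) ^ p)
  have hm := h.mul_eq_one
  simp only [twistConj, SL2_mul_apply, neg_neg, zpow_neg, i10, i11, u00, u10,
    h.a00, h.a01, h.a10, h.a11]
  generalize chebS (2 - c * d) (p - 1) = S at *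
  generalize chebS (2 - c * d) (p - 2) = T at *
  linear_combination (-c ^ 2 * d * S ^ 2 + c * S ^ 2 - c * S * T) * hm

theorem IsRileyPair.rileyPoly_eq_zero {p : ℤ} (hr : TwistRel p a b) (hc : c ≠ 0) :
    rileyPoly p (m ^ 2 + n ^ 2) (2 - c * d) = 0 := by
  obtain ⟨w00, w01, w10, w11⟩ := h.twistConj_b p
  have h10 := congrArg (fun x : SL(2, K) => x 1 0) hr
  simp only [SL2_mul_apply, h.a10, h.a11, h.b00, h.b10, w00, w10, w11] at h10
  have hm := h.mul_eq_one
  have hm0 : m ≠ 0 := left_ne_zero_of_mul_eq_one hm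
  refine mul_left_cancel₀ (mul_ne_zero hm0 hc) ?_
  rw [rileyPoly]
  generalize chebS (2 - c * d) (p - 1) = S at *
  generalize chebS (2 - c * d) (p - 2) = T at *
  linear_combination -h10 + (-m * c * S ^ 2 + m * c * S * T - n * c * S ^ 2 + n * c * S * T) * hm

theorem IsRileyPair.twistRel {p : ℤ} (hρ : rileyPoly p (m ^ 2 + n ^ 2) (2 - c * d) = 0) :
    TwistRel p a b := by
  obtain ⟨w00, w01, w10, w11⟩ := h.twistConj_b p
  have hm := h.mul_eq_one
  rw [TwistRel]
  rw [rileyPoly] at hρ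
  ext i j
  generalize chebS (2 - c * d) (p - 1) = S at *
  generalize chebS (2 - c * d) (p - 2) = T at *
  fin_cases i <;> fin_cases j <;>
    simp only [Fin.zero_eta, Fin.mk_one, SL2_mul_apply, h.a00, h.a01, h.a10, h.a11, h.b00, h.b01,
      h.b10, h.b11, w00, w01, w10, w11]
  · linear_combination c * d * hρ
  · linear_combination n * d * hρ
      + (m * d * S ^ 2 - m * d * S * T + n * d * S ^ 2 - n * d * S * T) * hm
  · linear_combination -m * c * hρ
      + (-m * c * S ^ 2 + m * c * S * T - n * c * S ^ 2 + n * c * S * T) * hm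
  · ring

/-- The eigenvalue of the longitude. Both sides of `X * λ = w⁻¹ * a ^ 2`, with
`X = u ^ (-p) * a * u ^ p`, are compared at the common eigenvector of `a` and `λ`. -/
theorem IsRileyPair.longitude_eq {p : ℤ} (hρ : rileyPoly p (m ^ 2 + n ^ 2) (2 - c * d) = 0)
    (hc : c ≠ 0) (hl : twistLongitude p a b 1 0 = 0) :
    ((1 - c * d) * chebS (2 - c * d) (p - 1) - chebS (2 - c * d) (p - 2)
        - m ^ 2 * (chebS (2 - c * d) (p - 1) - chebS (2 - c * d) (p - 2)))
        * twistLongitude p a b 0 0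
      = chebS (2 - c * d) (p - 1) - chebS (2 - c * d) (p - 2)
        - m ^ 2 * ((1 - c * d) * chebS (2 - c * d) (p - 1) - chebS (2 - c * d) (p - 2)) := by
  have hX : twistConj (-p) a b a * twistLongitude p a b = (twistConj p a b b)⁻¹ * a ^ 2 := by
    rw [twistLongitude]; group
  have h10 := congrArg (fun x : SL(2, K) => x 1 0) hX
  obtain ⟨i00, i01, i10, i11⟩ := SL2_inv_apply (twistConj p a b b)
  obtain ⟨w00, w01, w10, w11⟩ := h.twistConj_b p
  simp only [SL2_mul_apply, pow_two a, h.a00, h.a10, hl, i10, i11, h.twistConj_a p, w10] at h10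
  have hm := h.mul_eq_one
  rw [rileyPoly] at hρ
  have hS : chebS (2 - c * d) (p - 1) ≠ 0 := by
    intro h0; rw [h0] at hρ; simp at hρ
  refine mul_left_cancel₀ (mul_ne_zero hc hS) ?_
  generalize chebS (2 - c * d) (p - 1) = S at *
  generalize chebS (2 - c * d) (p - 2) = T at *
  linear_combination h10 + m ^ 2 * c * hρ + c * S * (S - T) * (m * n + 1) * hm

end Normalized

/-! ### The polynomial `B_{K_p}` -/

section TwistA

variable {R R' : Type*} [CommRing R] [CommRing R']

/-- The solution of `s (n + 2) = C * s (n + 1) - E * s n` with `s 0 = 0` and `s 1 = 1`. -/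
def lucasSeq (C E : R) : ℕ → R
  | 0 => 0
  | 1 => 1
  | n + 2 => C * lucasSeq C E (n + 1) - E * lucasSeq C E n

theorem map_lucasSeq (f : R →+* R') (C E : R) (n : ℕ) :
    f (lucasSeq C E n) = lucasSeq (f C) (f E) n := by
  induction n using Nat.twoStepInduction with
  | zero => simp [lucasSeq]
  | one => simp [lucasSeq]
  | more n h1 h2 => simp [lucasSeq, h1, h2]

theorem lucasSeq_mul (E c : R) (n : ℕ) :
    lucasSeq (E * c) (E ^ 2) (n + 1) = E ^ n * chebS c n ∧
      E * lucasSeq (E * c) (E ^ 2) n = E ^ n * chebS c (n - 1) := by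
  induction n with
  | zero => simp [lucasSeq, chebS_zero, chebS_neg_one]
  | succ n ih =>
    obtain ⟨h1, h2⟩ := ih
    have h := chebS_eq c (n + 1)
    rw [add_sub_cancel_right, show (n : ℤ) + 1 - 2 = n - 1 by ring] at h
    refine ⟨?_, ?_⟩
    · rw [lucasSeq]
      push_cast
      rw [h]
      linear_combination E * c * h1 - E * h2
    · push_cast
      rw [h1, add_sub_cancel_right]; ring

theorem lucasSeq_zero_succ (C : R) (n : ℕ) : lucasSeq C 0 (n + 1) = C ^ n := by
  induction n with
  | zero => simp [lucasSeq]
  | succ n ih => rw [lucasSeq, ih]; ring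

/-- The value at `(m² + l)² m²` times the trace parameter of `h_p`, `x = (l m² + 1) / (m² + l)`. -/
def twistC (l m : R) : R :=
  (m ^ 2 + l) ^ 2 * (m ^ 4 + m ^ 2 + 1) - (l * m ^ 2 + 1) * (m ^ 2 + l) * (m ^ 4 + 1)
    + (l * m ^ 2 + 1) ^ 2 * m ^ 2

/-- The polynomial `B_{K_p}(l, m)`, with denominators cleared in the recursion for `h_p`. -/
def twistA (p : ℤ) (l m : R) : R :=
  if 0 < p then
    (m ^ 6 + l) * lucasSeq (twistC l m) (((m ^ 2 + l) ^ 2 * m ^ 2) ^ 2) p.natAbs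
      - (m ^ 2 + l) ^ 3 * m ^ 4
        * lucasSeq (twistC l m) (((m ^ 2 + l) ^ 2 * m ^ 2) ^ 2) (p.natAbs - 1)
  else
    lucasSeq (twistC l m) (((m ^ 2 + l) ^ 2 * m ^ 2) ^ 2) (p.natAbs + 1)
      - (m ^ 2 + l) * (m ^ 6 + l)
        * lucasSeq (twistC l m) (((m ^ 2 + l) ^ 2 * m ^ 2) ^ 2) p.natAbs

theorem map_twistA (f : R →+* R') (p : ℤ) (l m : R) :
    f (twistA p l m) = twistA p (f l) (f m) := by
  unfold twistA twistC
  split_ifs <;> simp [map_lucasSeq]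

/-- The degree of `h_p` in `x`. -/
def twistDeg (p : ℤ) : ℕ := if 0 < p then 2 * p.natAbs - 1 else 2 * p.natAbs

/-- The defining expression of `B_{K_p}` in terms of `h_p`, over any ring in which `m` is a unit
(with inverse `n`) and `m² + l` divides `l m² + 1` (with quotient `x`). -/
theorem twistA_eq {l m n x : R} (hm : m * n = 1) (hx : x * (m ^ 2 + l) = l * m ^ 2 + 1) (p : ℤ) :
    twistA p l m =
      (m ^ 2 + l) ^ twistDeg p * (m ^ 2) ^ p.natAbs * twistH (m ^ 2 + n ^ 2) x p := by
  have hmn : m ^ 2 * n ^ 2 = 1 := by rw [← mul_pow, hm, one_pow]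
  have hC : twistC l m = (m ^ 2 + l) ^ 2 * m ^ 2 * twistTrace (m ^ 2 + n ^ 2) x := by
    rw [twistC, twistTrace, ← hx]
    linear_combination -(m ^ 2 + l) ^ 2 * (1 - x) * hmn
  have hA1 : m ^ 6 + l = (m ^ 2 + l) * m ^ 2 * (m ^ 2 + n ^ 2 - x) := by
    linear_combination m ^ 2 * hx - (m ^ 2 + l) * hmn
  rw [twistA, twistDeg, hC, hA1, twistH]
  generalize twistTrace (m ^ 2 + n ^ 2) x = c
  generalize m ^ 2 + n ^ 2 - x = y
  split_ifs with hp
  · obtain ⟨k, hk⟩ : ∃ k, p.natAbs = k + 1 := ⟨p.natAbs - 1, by omega⟩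
    have hpk : p = k + 1 := by omega
    obtain ⟨h1, h2⟩ := lucasSeq_mul ((m ^ 2 + l) ^ 2 * m ^ 2) c k
    rw [hk, Nat.add_sub_cancel, h1, show 2 * (k + 1) - 1 = 2 * k + 1 by omega, hpk,
      add_sub_cancel_right, show (k : ℤ) + 1 - 2 = k - 1 by ring]
    simp only [mul_pow] at h2
    simp only [mul_pow, pow_add, pow_mul] at h2 ⊢
    linear_combination -(m ^ 2 + l) * m ^ 2 * h2
  · obtain ⟨k, hk⟩ : ∃ k, p.natAbs = k := ⟨_, rfl⟩
    have hpk : p = -k := by omega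
    obtain ⟨h1, h2⟩ := lucasSeq_mul ((m ^ 2 + l) ^ 2 * m ^ 2) c k
    have n1 : chebS c (-k - 1) = -chebS c (k - 1) := by
      simp [chebS, Polynomial.Chebyshev.S_neg_sub_one]
    have n2 : chebS c (-k - 2) = -chebS c k := by
      simp [chebS, Polynomial.Chebyshev.S_neg_sub_two]
    rw [hk, h1, hpk, n1, n2]
    simp only [mul_pow, pow_mul] at h2 ⊢
    linear_combination -y * h2

theorem twistTrace_sub_one (M : R) : twistTrace M (M - 1) = 2 := by
  rw [twistTrace]; ring

theorem twistH_sub_one (M : R) (p : ℤ) : twistH M (M - 1) p = 1 := by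
  rw [twistH, twistTrace_sub_one, chebS_two, chebS_two]
  push_cast; ring

/-- On the curve `l = m⁴`, where the trace parameter is `2`, the value of `h_p` is `1`. -/
theorem twistA_pow_four {m n : R} (hm : m * n = 1) (p : ℤ) :
    twistA p (m ^ 4) m = (m ^ 2 + m ^ 4) ^ twistDeg p * (m ^ 2) ^ p.natAbs := by
  have hmn : m ^ 2 * n ^ 2 = 1 := by rw [← mul_pow, hm, one_pow]
  rw [twistA_eq hm (x := m ^ 2 + n ^ 2 - 1) _ p, twistH_sub_one, mul_one]
  linear_combination (1 + m ^ 2) * hmn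

end TwistA

section TwistAField

variable {K : Type*} [Field K] {l m n : K}

theorem twistA_ne_zero_of_add_eq_zero (hm : m ≠ 0) (hm4 : m ^ 4 ≠ 1) (hD : m ^ 2 + l = 0)
    (p : ℤ) : twistA p l m ≠ 0 := by
  have h4 : 1 - m ^ 4 ≠ 0 := sub_ne_zero.2 hm4.symm
  have hl : l = -m ^ 2 := by linear_combination hD
  have hC : twistC l m = (1 - m ^ 4) ^ 2 * m ^ 2 := by rw [twistC, hl]; ring
  have hA : m ^ 6 + l = -(m ^ 2 * (1 - m ^ 4)) := by rw [hl]; ring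
  have hC0 : twistC l m ≠ 0 := by rw [hC]; positivity
  have hA0 : m ^ 6 + l ≠ 0 := by rw [hA]; exact neg_ne_zero.2 (by positivity)
  rw [twistA, hD]
  split_ifs with hp
  · obtain ⟨k, hk⟩ : ∃ k, p.natAbs = k + 1 := ⟨p.natAbs - 1, by omega⟩
    simp [hk, lucasSeq_zero_succ, hC0, hA0]
  · simp [lucasSeq_zero_succ, hC0]

/-- For every value of `m` there is a value of `l` at which `B_{K_p}` does not vanish. -/
theorem exists_twistA_ne_zero [CharZero K] (m : K) (p : ℤ) : ∃ l, twistA p l m ≠ 0 := by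
  by_cases hm : m = 0
  · refine ⟨2, ?_⟩
    have hC : twistC (2 : K) 0 = 2 := by rw [twistC]; norm_num
    subst hm
    rw [twistA, hC]
    split_ifs with hp
    · obtain ⟨k, hk⟩ : ∃ k, p.natAbs = k + 1 := ⟨p.natAbs - 1, by omega⟩
      simp [hk, lucasSeq_zero_succ]
    · obtain hk | ⟨k, hk⟩ : p.natAbs = 0 ∨ ∃ k, p.natAbs = k + 1 := by
        rcases h : p.natAbs with _ | k
        · exact Or.inl rfl
        · exact Or.inr ⟨k, rfl⟩
      · simp [hk, lucasSeq]
      · simp only [hk, ne_eq, OfNat.ofNat_ne_zero, not_false_eq_true, zero_pow, zero_add, mul_zero,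
          lucasSeq_zero_succ]
        intro h
        have h2 : (2 : K) ^ (k + 1) = 0 := by linear_combination -h
        exact pow_ne_zero _ two_ne_zero h2
  · have hmn := mul_inv_cancel₀ hm
    by_cases hm2 : m ^ 2 = -1
    · refine ⟨0, ?_⟩
      have hi : m⁻¹ ^ 2 = -1 := by rw [inv_pow, hm2]; norm_num
      rw [twistA_eq hmn (x := -1) (by rw [hm2]; ring) p, hm2, hi]
      -- the value of `h_p` is a square root of `1`
      have h1 := one_sub_mul_twistH (-1 + -1 : K) (-1) p
      have ht : twistTrace (-1 + -1 : K) (-1) = -2 := by rw [twistTrace]; norm_num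
      have h2 := chebS_sq_add_sq (-2 : K) (p - 1)
      rw [show p - 1 - 1 = p - 2 by ring] at h2
      rw [ht] at h1
      have h3 : twistH (-1 + -1 : K) (-1) p ≠ 0 := by
        intro h0
        rw [h0] at h1
        have h4 : chebS (-2 : K) (p - 1) + chebS (-2 : K) (p - 2) = 0 := by
          refine mul_left_cancel₀ (two_ne_zero (α := K)) ?_
          linear_combination h1
        have h5 : (1 : K) = 0 := by
          rw [← h2]
          linear_combination (chebS (-2 : K) (p - 1) + chebS (-2 : K) (p - 2)) * h4
        exact one_ne_zero h5
      simp [h3]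
    · refine ⟨m ^ 4, ?_⟩
      rw [twistA_pow_four hmn]
      have h1 : m ^ 2 + m ^ 4 ≠ 0 := by
        intro h0
        rcases mul_eq_zero.1 (show m ^ 2 * (m ^ 2 + 1) = 0 by linear_combination h0) with h | h
        · exact hm (by simpa using h)
        · exact hm2 (by linear_combination h)
      positivity

/-- Points given by an irreducible representation lie on the curve `B_{K_p} = 0`. -/
theorem twistA_eq_zero_of_rileyPoly {p : ℤ} {t : K} (hm : m * n = 1) (ht : t ≠ 2)
    (hρ : rileyPoly p (m ^ 2 + n ^ 2) t = 0)
    (hl : ((t - 1) * chebS t (p - 1) - chebS t (p - 2)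
        - m ^ 2 * (chebS t (p - 1) - chebS t (p - 2))) * l
      = chebS t (p - 1) - chebS t (p - 2)
        - m ^ 2 * ((t - 1) * chebS t (p - 1) - chebS t (p - 2))) :
    twistA p l m = 0 := by
  have hS := chebS_sq_add_sq t (p - 1)
  rw [show p - 1 - 1 = p - 2 by ring] at hS
  rw [rileyPoly] at hρ
  have key := fun x => one_sub_mul_twistH (m ^ 2 + n ^ 2) x p
  have hST : chebS t (p - 1) - chebS t (p - 2) ≠ 0 := by
    intro h0; rw [h0] at hρ; simp at hρ
  have hS0 : chebS t (p - 1) ≠ 0 := by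
    intro h0; rw [h0] at hρ; simp at hρ
  obtain ⟨x, hx⟩ : ∃ x, x * (chebS t (p - 1) - chebS t (p - 2))
      = (t - 1) * chebS t (p - 1) - chebS t (p - 2) := ⟨_, div_mul_cancel₀ _ hST⟩
  have hxD : x * (m ^ 2 + l) = l * m ^ 2 + 1 := by
    refine mul_left_cancel₀ hST ?_
    linear_combination hl + (m ^ 2 + l) * hx
  have htr : twistTrace (m ^ 2 + n ^ 2) x = t := by
    refine mul_left_cancel₀ (pow_ne_zero 2 hST) ?_
    rw [twistTrace]
    generalize chebS t (p - 1) = S at *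
    generalize chebS t (p - 2) = T at *
    linear_combination (-(m ^ 2 + n ^ 2) * (S - T) + x * (S - T) + (t - 1) * S - T) * hx
      - (2 - t) * hρ + (2 - t) * hS
  have hx1 : 1 - x ≠ 0 := by
    intro h0
    have : (2 - t) * chebS t (p - 1) = 0 := by
      linear_combination (chebS t (p - 1) - chebS t (p - 2)) * h0 + hx
    rcases mul_eq_zero.1 this with h | h
    · exact ht (by linear_combination -h)
    · exact hS0 h
  have hH : twistH (m ^ 2 + n ^ 2) x p = 0 := by
    refine mul_left_cancel₀ hx1 ?_
    rw [key, htr]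
    linear_combination -hx
  rw [twistA_eq hm hxD, hH, mul_zero]

/-- Points of the curve `B_{K_p} = 0` off the lines `l = 1`, `m = 0` and `m⁴ = 1` come from a zero
of the Riley polynomial. -/
theorem exists_rileyPoly_of_twistA_eq_zero [CharZero K] {p : ℤ} (hm : m * n = 1) (hm4 : m ^ 4 ≠ 1)
    (hl1 : l ≠ 1) (hA : twistA p l m = 0) :
    ∃ t, t ≠ 2 ∧ rileyPoly p (m ^ 2 + n ^ 2) t = 0 ∧
      ((t - 1) * chebS t (p - 1) - chebS t (p - 2)
        - m ^ 2 * (chebS t (p - 1) - chebS t (p - 2))) ≠ 0 ∧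
      ((t - 1) * chebS t (p - 1) - chebS t (p - 2)
        - m ^ 2 * (chebS t (p - 1) - chebS t (p - 2))) * l
      = chebS t (p - 1) - chebS t (p - 2)
        - m ^ 2 * ((t - 1) * chebS t (p - 1) - chebS t (p - 2)) := by
  have hm0 : m ≠ 0 := left_ne_zero_of_mul_eq_one hm
  have hD : m ^ 2 + l ≠ 0 := fun h => twistA_ne_zero_of_add_eq_zero hm0 hm4 h p hA
  obtain ⟨x, hx⟩ : ∃ x, x * (m ^ 2 + l) = l * m ^ 2 + 1 := ⟨_, div_mul_cancel₀ _ hD⟩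
  rw [twistA_eq hm hx] at hA
  have hH : twistH (m ^ 2 + n ^ 2) x p = 0 := by
    rcases mul_eq_zero.1 hA with h | h
    · exact absurd h (mul_ne_zero (pow_ne_zero _ hD) (pow_ne_zero _ (pow_ne_zero _ hm0)))
    · exact h
  have hx1 : 1 - x ≠ 0 := by
    intro h0
    have h1 : (l - 1) * (m ^ 2 - 1) = 0 := by linear_combination -hx - (m ^ 2 + l) * h0
    rcases mul_eq_zero.1 h1 with h | h
    · exact hl1 (by linear_combination h)
    · exact hm4 (by linear_combination (m ^ 2 + 1) * h)
  have key := one_sub_mul_twistH (m ^ 2 + n ^ 2) x p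
  rw [hH, mul_zero] at key
  obtain ⟨t, htr⟩ : ∃ t, twistTrace (m ^ 2 + n ^ 2) x = t := ⟨_, rfl⟩
  have ht : t ≠ 2 := by
    rintro rfl
    have hxM : x = m ^ 2 + n ^ 2 - 1 := by
      rw [twistTrace] at htr
      have h1 : (1 - x) * (m ^ 2 + n ^ 2 - 1 - x) = 0 := by linear_combination htr
      rcases mul_eq_zero.1 h1 with h | h
      · exact absurd h hx1
      · linear_combination -h
    rw [hxM, twistH_sub_one] at hH
    exact one_ne_zero hH
  have hS := chebS_sq_add_sq t (p - 1)
  rw [show p - 1 - 1 = p - 2 by ring] at hS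
  rw [htr] at key
  rw [twistTrace] at htr
  have hρ : rileyPoly p (m ^ 2 + n ^ 2) t = 0 := by
    have h2t : 2 - t ≠ 0 := sub_ne_zero.2 ht.symm
    refine mul_left_cancel₀ h2t ?_
    rw [rileyPoly]
    generalize chebS t (p - 1) = S at *
    generalize chebS t (p - 2) = T at *
    linear_combination -(S - T) ^ 2 * htr
      + (-(m ^ 2 + n ^ 2) * (S - T) + x * (S - T) + (t - 1) * S - T) * key + (2 - t) * hS
  have hST : chebS t (p - 1) - chebS t (p - 2) ≠ 0 := by
    intro h0; rw [rileyPoly, h0] at hρ; simp at hρ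
  refine ⟨t, ht, hρ, ?_, ?_⟩
  · have hxm : x - m ^ 2 ≠ 0 := by
      intro h0
      exact hm4 (by linear_combination hx - (m ^ 2 + l) * h0)
    have : (t - 1) * chebS t (p - 1) - chebS t (p - 2)
        - m ^ 2 * (chebS t (p - 1) - chebS t (p - 2))
        = (x - m ^ 2) * (chebS t (p - 1) - chebS t (p - 2)) := by linear_combination -key
    rw [this]
    exact mul_ne_zero hxm hST
  · linear_combination (chebS t (p - 1) - chebS t (p - 2)) * hx - (m ^ 2 + l) * key

end TwistAField

/-! ### The eigenvalue set of a twist knot -/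

section EigenvalueSet

theorem mem_eigenvalueSet_twistKnot {p : ℤ} {v : Fin 2 → ℂ} :
    v ∈ (twistKnot p).eigenvalueSet ↔ ∃ a b : SL(2, ℂ), TwistRel p a b ∧ a 1 0 = 0 ∧
      twistLongitude p a b 1 0 = 0 ∧ v 1 = a 0 0 ∧ v 0 = twistLongitude p a b 0 0 := by
  constructor
  · rintro ⟨ρ, h1, h2, h3, h4⟩
    obtain ⟨b, hr, hb⟩ := exists_hom_twistKnot_iff.1 ⟨ρ, rfl, rfl⟩
    rw [hb] at h2 h4
    exact ⟨_, b, hr, h1, h2, h3, h4⟩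
  · rintro ⟨a, b, hr, h1, h2, h3, h4⟩
    obtain ⟨ρ, ha, hb⟩ := exists_hom_twistKnot_iff.2 ⟨b, hr, rfl⟩
    rw [← ha] at h1 h3
    rw [← hb] at h2 h4
    exact ⟨ρ, h1, h2, h3, h4⟩

/-- Up to conjugation by a unipotent upper triangular matrix, a pair of matrices that generates a
non-triangular representation is in normal form. -/
theorem TwistRel.exists_isRileyPair {K : Type*} [Field K] {p : ℤ} {a b : SL(2, K)}
    (hr : TwistRel p a b) (ha : a 1 0 = 0) (hb : b 1 0 ≠ 0) (hl : twistLongitude p a b 1 0 = 0) :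
    ∃ (d : K) (a' b' : SL(2, K)), IsRileyPair (a 0 0) (a 1 1) (b 1 0) d a' b' ∧
      TwistRel p a' b' ∧ twistLongitude p a' b' 1 0 = 0 ∧
      twistLongitude p a' b' 0 0 = twistLongitude p a b 0 0 := by
  have hda := SL2_det a
  rw [ha, mul_zero, sub_zero] at hda
  -- `a` and `b` are conjugate and so have the same trace
  have htr : b 0 0 + b 1 1 = a 0 0 + a 1 1 := by
    have hc : twistConj p a b b * b * (twistConj p a b b)⁻¹ = a := by
      rw [show twistConj p a b b * b = a * twistConj p a b b from hr]; group
    obtain ⟨i1, i2, i3, i4⟩ := SL2_inv_apply (twistConj p a b b)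
    have hw := SL2_det (twistConj p a b b)
    have h0 := congrArg (fun x : SL(2, K) => x 0 0 + x 1 1) hc
    simp only [SL2_mul_apply, i1, i2, i3, i4] at h0
    rw [← h0]
    linear_combination -(b 0 0 + b 1 1) * hw
  obtain ⟨s, hs⟩ : ∃ s, s * b 1 0 = a 0 0 - b 0 0 := ⟨_, div_mul_cancel₀ _ hb⟩
  let g : SL(2, K) := ⟨!![1, s; 0, 1], by simp [Matrix.det_fin_two]⟩
  have hg0 : g 0 0 = 1 ∧ g 0 1 = s ∧ g 1 0 = 0 ∧ g 1 1 = 1 := by simp [g]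
  obtain ⟨g1, g2, g3, g4⟩ := hg0
  obtain ⟨i1, i2, i3, i4⟩ := SL2_inv_apply g
  have hg (x : SL(2, K)) : MulAut.conj g x 0 0 = x 0 0 + s * x 1 0 ∧
      MulAut.conj g x 0 1 = x 0 1 + s * x 1 1 - s * (x 0 0 + s * x 1 0) ∧
      MulAut.conj g x 1 0 = x 1 0 ∧ MulAut.conj g x 1 1 = x 1 1 - s * x 1 0 := by
    rw [MulAut.conj_apply]
    simp only [SL2_mul_apply, i1, i2, i3, i4, g1, g2, g3, g4]
    refine ⟨by ring, by ring, by ring, by ring⟩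
  obtain ⟨a00, a01, a10, a11⟩ := hg a
  obtain ⟨b00, b01, b10, b11⟩ := hg b
  have hL := map_twistLongitude (MulAut.conj g).toMonoidHom p a b
  rw [MulEquiv.coe_toMonoidHom] at hL
  obtain ⟨l00, l01, l10, l11⟩ := hg (twistLongitude p a b)
  rw [ha, mul_zero, add_zero] at a00
  rw [ha, mul_zero, sub_zero] at a11
  rw [hL, hl, mul_zero, add_zero] at l00
  rw [hL, hl] at l10
  refine ⟨_, MulAut.conj g a, MulAut.conj g b,
    ⟨hda, a00, rfl, a10.trans ha, a11, ?_, ?_, b10, ?_⟩,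
    hr.map (MulAut.conj g).toMonoidHom, l10, l00⟩
  · rw [b00]; linear_combination hs
  · -- the determinant of the conjugated matrix determines its last entry
    rw [b01]
    refine mul_right_cancel₀ hb ?_
    have hdb := SL2_det b
    linear_combination (b 1 1 - s * b 1 0 - a 0 0) * hs - hdb + hda + a 0 0 * htr
  · rw [b11]; linear_combination htr - hs

theorem twistA_eq_zero_of_mem_eigenvalueSet {p : ℤ} {v : Fin 2 → ℂ}
    (hv : v ∈ (twistKnot p).eigenvalueSet) : (v 0 - 1) * twistA p (v 0) (v 1) = 0 := by
  obtain ⟨a, b, hr, ha, hl, hm, hv0⟩ := mem_eigenvalueSet_twistKnot.1 hv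
  rw [hm, hv0]
  by_cases hb : b 1 0 = 0
  · rw [twistLongitude_apply_of_upper hr ha hb]; ring
  · obtain ⟨d, a', b', h, hr', hl', hl0⟩ := hr.exists_isRileyPair ha hb hl
    rw [← hl0]
    by_cases hd : d = 0
    · rw [twistLongitude_apply_of_lower hr' (h.a01.trans hd) h.b01 hl']; ring
    · have hρ := h.rileyPoly_eq_zero hr' hb
      have ht : 2 - b 1 0 * d ≠ 2 := by simp [hb, hd]
      rw [twistA_eq_zero_of_rileyPoly h.mul_eq_one ht hρ, mul_zero]
      have := h.longitude_eq hρ hb hl'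
      linear_combination this

theorem mem_eigenvalueSet_of_twistA_eq_zero {p : ℤ} {v : Fin 2 → ℂ} (hm : v 1 ≠ 0)
    (hm4 : v 1 ^ 4 ≠ 1) (hA : (v 0 - 1) * twistA p (v 0) (v 1) = 0) :
    v ∈ (twistKnot p).eigenvalueSet := by
  rw [mem_eigenvalueSet_twistKnot]
  have hmn := mul_inv_cancel₀ hm
  by_cases hl1 : v 0 = 1
  · -- an abelian representation
    let a : SL(2, ℂ) := ⟨!![v 1, 0; 0, (v 1)⁻¹], by simp [Matrix.det_fin_two, hmn]⟩
    have h1 : TwistRel p a a := by simp [TwistRel, twistConj]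
    have h2 : twistLongitude p a a = 1 := by simp [twistLongitude, twistConj, pow_two]
    refine ⟨a, a, h1, by simp [a], by simp [h2], by simp [a], by simp [h2, hl1]⟩
  · have hA' := (mul_eq_zero.1 hA).resolve_left (sub_ne_zero.2 hl1)
    obtain ⟨t, ht, hρ, hne, hlt⟩ := exists_rileyPoly_of_twistA_eq_zero hmn hm4 hl1 hA'
    let a : SL(2, ℂ) := ⟨!![v 1, 1; 0, (v 1)⁻¹], by simp [Matrix.det_fin_two, hmn]⟩
    let b : SL(2, ℂ) := ⟨!![v 1, 0; 2 - t, (v 1)⁻¹], by simp [Matrix.det_fin_two, hmn]⟩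
    have h : IsRileyPair (v 1) (v 1)⁻¹ (2 - t) 1 a b := by
      constructor <;> simp [a, b, hmn]
    have htt : 2 - (2 - t) * 1 = t := by ring
    have hρ' : rileyPoly p (v 1 ^ 2 + (v 1)⁻¹ ^ 2) (2 - (2 - t) * 1) = 0 := by rwa [htt]
    have hr := h.twistRel hρ'
    -- the longitude commutes with `a`, whose eigenvalues are different
    have hl : twistLongitude p a b 1 0 = 0 := by
      have h10 := congrArg (fun x : SL(2, ℂ) => x 1 0) hr.commute.eq
      simp only [SL2_mul_apply, h.a00, h.a10, h.a11] at h10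
      have h2 : (v 1 ^ 2 - 1) * twistLongitude p a b 1 0 = 0 := by
        linear_combination v 1 * h10 + twistLongitude p a b 1 0 * hmn
      refine (mul_eq_zero.1 h2).resolve_left fun h0 => hm4 ?_
      linear_combination (v 1 ^ 2 + 1) * h0
    have hlong := h.longitude_eq hρ' (sub_ne_zero.2 ht.symm) hl
    rw [htt] at hlong
    refine ⟨a, b, hr, h.a10, hl, h.a00.symm, ?_⟩
    refine mul_left_cancel₀ hne ?_
    linear_combination hlt - hlong

end EigenvalueSet

/-! ### Components of plane curves -/

section PlaneCurves

open MvPolynomial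

theorem irreducible_X_sub_C {σ : Type*} (i : σ) (a : ℂ) :
    Irreducible (X i - C a : MvPolynomial σ ℂ) := by
  have h := irreducible_mul_X_add (1 : MvPolynomial σ ℂ) (C (-a)) i one_ne_zero (by simp)
    (by simp) isRelPrime_one_left
  rwa [one_mul, map_neg, ← sub_eq_add_neg] at h

/-- An irreducible polynomial divides every polynomial that vanishes on its zero set. -/
theorem Irreducible.exists_aeval_eq_zero {σ : Type*} [Finite σ] {f g : MvPolynomial σ ℂ}
    (hf : Irreducible f) (hg : ¬ f ∣ g) : ∃ v : σ → ℂ, aeval v f = 0 ∧ aeval v g ≠ 0 := by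
  by_contra! hcon
  have hp : (Ideal.span {f}).IsPrime := (Ideal.span_singleton_prime hf.ne_zero).2 hf.prime
  have h1 : g ∈ vanishingIdeal ℂ (zeroLocus ℂ (Ideal.span {f})) := fun v hv =>
    hcon v (hv f (Ideal.mem_span_singleton_self f))
  rw [IsPrime.vanishingIdeal_zeroLocus] at h1
  exact hg (Ideal.mem_span_singleton.1 h1)

/-- A plane curve has dimension one: at most one because `f` is not a zero divisor, and not zero
because no maximal ideal of `ℂ[l, m]` is principal. -/
theorem ringKrullDim_quotient_span_irreducible {f : MvPolynomial (Fin 2) ℂ} (hf : Irreducible f) :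
    ringKrullDim (MvPolynomial (Fin 2) ℂ ⧸ Ideal.span {f}) = 1 := by
  have hp : (Ideal.span {f}).IsPrime := (Ideal.span_singleton_prime hf.ne_zero).2 hf.prime
  have hle : ringKrullDim (MvPolynomial (Fin 2) ℂ ⧸ Ideal.span {f}) + 1 ≤ 1 + 1 := by
    have h := ringKrullDim_quotient_succ_le_of_nonZeroDivisor (mem_nonZeroDivisors_of_ne_zero
      hf.ne_zero)
    rw [MvPolynomial.ringKrullDim_of_isNoetherianRing, ringKrullDim_eq_zero_of_field] at h
    simpa [one_add_one_eq_two] using h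
  have hnm : ¬ (Ideal.span {f}).IsMaximal := by
    intro hmax
    -- a maximal ideal contains the two linear polynomials of a point, which are not associated
    obtain ⟨x, hx⟩ := isMaximal_iff_eq_vanishingIdeal_singleton.1 hmax
    have hd (i : Fin 2) : Associated f (X i - C (x i)) := by
      refine hf.associated_of_dvd (irreducible_X_sub_C i (x i)) (Ideal.mem_span_singleton.1 ?_)
      rw [hx, mem_vanishingIdeal_singleton_iff]
      simp
    obtain ⟨u, hu⟩ := ((hd 0).symm.trans (hd 1)).dvd
    have h := congrArg (aeval ![x 0 , x 1 + 1]) hu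
    simp at h
  refine le_antisymm ?_ (not_lt.1 fun hlt => hnm ?_)
  · exact ENat.WithBot.add_le_add_one_right_iff.1 hle
  · have hlt' := ENat.WithBot.lt_add_one_iff (m := 0) |>.1 (by simpa using hlt)
    have := Ring.krullDimLE_iff.2 hlt'
    exact Ideal.bot_quotient_isMaximal_iff _ |>.1 (Ideal.isMaximal_of_isPrime ⊥)

/-- If the polynomial `P` vanishes on `S`, and every polynomial that vanishes on `S` is divisible by
all irreducible factors of `P`, then the curve components of `S` are the zero sets of these
factors. -/
theorem curveComponents_eq {S : Set (Fin 2 → ℂ)} {P : MvPolynomial (Fin 2) ℂ} (hP0 : P ≠ 0)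
    (hS : P ∈ vanishingIdeal ℂ S)
    (h : ∀ f, Irreducible f → f ∣ P → vanishingIdeal ℂ S ≤ Ideal.span {f}) :
    curveComponents S = {𝔭 | ∃ f, Irreducible f ∧ f ∣ P ∧ 𝔭 = Ideal.span {f}} := by
  have key {𝔮 : Ideal (MvPolynomial (Fin 2) ℂ)} (hq : 𝔮.IsPrime) (hS' : vanishingIdeal ℂ S ≤ 𝔮) :
      ∃ f, Irreducible f ∧ f ∣ P ∧ Ideal.span {f} ≤ 𝔮 := by
    obtain ⟨s, hs, hsP⟩ := UniqueFactorizationMonoid.exists_prime_factors P hP0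
    have hmem : s.prod ∈ 𝔮 := by
      obtain ⟨u, hu⟩ := hsP.symm
      rw [← hu]
      exact 𝔮.mul_mem_right _ (hS' hS)
    obtain ⟨f, hfs, hf⟩ := (hq.multiset_prod_mem_iff_exists_mem s).1 hmem
    exact ⟨f, (hs f hfs).irreducible, (Multiset.dvd_prod hfs).trans hsP.dvd,
      (Ideal.span_singleton_le_iff_mem _).2 hf⟩
  ext 𝔭
  constructor
  · rintro ⟨hmin, -⟩
    obtain ⟨f, hf, hfP, hle⟩ := key hmin.1.1 hmin.1.2
    have hp : (Ideal.span {f}).IsPrime := (Ideal.span_singleton_prime hf.ne_zero).2 hf.prime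
    exact ⟨f, hf, hfP, le_antisymm (hmin.2 ⟨hp, h f hf hfP⟩ hle) hle⟩
  · rintro ⟨f, hf, hfP, rfl⟩
    have hp : (Ideal.span {f}).IsPrime := (Ideal.span_singleton_prime hf.ne_zero).2 hf.prime
    refine ⟨⟨⟨hp, h f hf hfP⟩, ?_⟩, ringKrullDim_quotient_span_irreducible hf⟩
    intro 𝔮 hq hle
    obtain ⟨g, hg, hgP, hgq⟩ := key hq.1 hq.2
    refine le_trans ?_ hgq
    have hfg : f ∣ g := Ideal.mem_span_singleton.1 (hle (hgq (Ideal.mem_span_singleton_self g)))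
    exact (Ideal.span_singleton_le_span_singleton).2 (hf.associated_of_dvd hg hfg).symm.dvd

/-- A squarefree polynomial is the product of suitable generators of the prime ideals of its
irreducible factors. -/
theorem Squarefree.exists_eq_finprod {P : MvPolynomial (Fin 2) ℂ} (hP : Squarefree P) (hP0 : P ≠ 0)
    {g : MvPolynomial (Fin 2) ℂ} (hg : Irreducible g) (hgP : g ∣ P) :
    ∃ F : Ideal (MvPolynomial (Fin 2) ℂ) → MvPolynomial (Fin 2) ℂ,
      (∀ 𝔭 ∈ {𝔭 | ∃ f, Irreducible f ∧ f ∣ P ∧ 𝔭 = Ideal.span {f}}, 𝔭 = Ideal.span {F 𝔭}) ∧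
      P = ∏ᶠ 𝔭 ∈ {𝔭 | ∃ f, Irreducible f ∧ f ∣ P ∧ 𝔭 = Ideal.span {f}}, F 𝔭 := by
  classical
  set C := {𝔭 : Ideal (MvPolynomial (Fin 2) ℂ) | ∃ f, Irreducible f ∧ f ∣ P ∧ 𝔭 = Ideal.span {f}}
    with hC
  have hfin : C.Finite := by
    refine ((UniqueFactorizationMonoid.factors P).toFinset.finite_toSet.image
      fun f => Ideal.span {f}).subset ?_
    rintro _ ⟨f, hf, hfP, rfl⟩
    obtain ⟨q, hq, hfq⟩ := UniqueFactorizationMonoid.exists_mem_factors_of_dvd hP0 hf hfP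
    exact ⟨q, by simpa using hq, (Ideal.span_singleton_eq_span_singleton.2 hfq).symm⟩
  have hch (𝔭) : ∃ f, 𝔭 ∈ C → Irreducible f ∧ f ∣ P ∧ 𝔭 = Ideal.span {f} := by
    by_cases h : 𝔭 ∈ C
    · obtain ⟨f, hf⟩ := h
      exact ⟨f, fun _ => hf⟩
    · exact ⟨0, fun h' => absurd h' h⟩
  choose G hG using hch
  -- the product of the chosen generators divides `P`, and the quotient is a unit
  have hdvd : ∏ 𝔭 ∈ hfin.toFinset, G 𝔭 ∣ P := by
    refine Finset.prod_dvd_of_isRelPrime ?_ fun 𝔭 h𝔭 => (hG 𝔭 (hfin.mem_toFinset.1 h𝔭)).2.1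
    intro 𝔭 h𝔭 𝔮 h𝔮 hne
    obtain ⟨i1, -, e1⟩ := hG 𝔭 (hfin.mem_toFinset.1 h𝔭)
    obtain ⟨i2, -, e2⟩ := hG 𝔮 (hfin.mem_toFinset.1 h𝔮)
    refine (i1.isRelPrime_iff_not_dvd).2 fun hd => hne ?_
    rw [e1, e2, Ideal.span_singleton_eq_span_singleton]
    exact i1.associated_of_dvd i2 hd
  obtain ⟨r, hr⟩ := hdvd
  have hru : IsUnit r := by
    by_contra hnu
    have hr0 : r ≠ 0 := by rintro rfl; exact hP0 (by rw [hr, mul_zero])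
    obtain ⟨f, hf, hfr⟩ := WfDvdMonoid.exists_irreducible_factor hnu hr0
    have hfC : Ideal.span {f} ∈ C := ⟨f, hf, hfr.trans ⟨_, hr.trans (mul_comm _ _)⟩, rfl⟩
    have hfG : f ∣ ∏ 𝔭 ∈ hfin.toFinset, G 𝔭 := by
      refine dvd_trans ?_ (Finset.dvd_prod_of_mem G (hfin.mem_toFinset.2 hfC))
      exact (Ideal.span_singleton_eq_span_singleton.1 (hG _ hfC).2.2).dvd
    exact hf.not_isUnit (hP f (hr ▸ mul_dvd_mul hfG hfr))
  refine ⟨fun 𝔭 => (if 𝔭 = Ideal.span {g} then r else 1) * G 𝔭, ?_, ?_⟩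
  · intro 𝔭 h𝔭
    conv_lhs => rw [(hG 𝔭 h𝔭).2.2]
    rw [Ideal.span_singleton_eq_span_singleton]
    beta_reduce
    split_ifs
    · exact (associated_unit_mul_left _ _ hru).symm
    · rw [one_mul]
  · rw [finprod_mem_eq_finite_toFinset_prod _ hfin, Finset.prod_mul_distrib,
      Finset.prod_ite_eq', if_pos (hfin.mem_toFinset.2 ⟨g, hg, hgP, rfl⟩), mul_comm]
    exact hr

end PlaneCurves

/-! ### The curve `(l - 1) B_{K_p} = 0` is reduced -/

section Reduced

open TrivSqZeroExt

theorem chebS_inl (c : ℂ) (k : ℤ) : chebS (inl c : DualNumber ℂ) k = inl (chebS c k) :=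
  (map_chebS (inlHom ℂ ℂ) c k).symm

/-- The curve `B_{K_p} = 0` is smooth off the lines `l = 1`, `m = 0` and `m⁴ = 1`: through each of
its points there is a tangent vector of the plane that is not tangent to the curve. Along this
vector the trace parameter `c` is constant, while `x` is not, so that the equation
`S_p - S_{p-1} = x (S_{p-1} - S_{p-2})` at `c`, which defines the curve, is violated. -/
theorem exists_dualNumber_twistA_ne_zero {p : ℤ} {l m : ℂ} (hm : m ≠ 0) (hm4 : m ^ 4 ≠ 1)
    (hl : l ≠ 1) (hA : twistA p l m = 0) :
    ∃ l' m' : ℂ, twistA p (inl l + inr l' : DualNumber ℂ) (inl m + inr m') ≠ 0 := by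
  have hD : m ^ 2 + l ≠ 0 := fun h => twistA_ne_zero_of_add_eq_zero hm hm4 h p hA
  obtain ⟨n, hmn⟩ : ∃ n, m * n = 1 := ⟨_, mul_inv_cancel₀ hm⟩
  obtain ⟨x, hx⟩ : ∃ x, x * (m ^ 2 + l) = l * m ^ 2 + 1 := ⟨_, div_mul_cancel₀ _ hD⟩
  have hx1 : 1 - x ≠ 0 := by
    intro h0
    have h1 : (l - 1) * (m ^ 2 - 1) = 0 := by linear_combination -hx - (m ^ 2 + l) * h0
    rcases mul_eq_zero.1 h1 with h | h
    · exact hl (by linear_combination h)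
    · exact hm4 (by linear_combination (m ^ 2 + 1) * h)
  have hxm : x - m ^ 2 ≠ 0 := fun h0 => hm4 (by linear_combination hx - (m ^ 2 + l) * h0)
  have hmn3 : m - n ^ 3 ≠ 0 := by
    intro h0
    exact hm4 (by linear_combination m ^ 3 * h0 + (1 + m * n + (m * n) ^ 2) * hmn)
  obtain ⟨μ, hμ⟩ : ∃ μ, μ * (1 - x) = m ^ 2 + n ^ 2 - 2 * x := ⟨_, div_mul_cancel₀ _ hx1⟩
  obtain ⟨b, hb⟩ : ∃ b, b * (m - n ^ 3) = μ / 2 := ⟨_, div_mul_cancel₀ _ hmn3⟩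
  obtain ⟨e, he⟩ : ∃ e, e * (x - m ^ 2) = 2 * l * m * b - (m ^ 2 + l) - 2 * x * m * b :=
    ⟨_, div_mul_cancel₀ _ hxm⟩
  refine ⟨e, b, fun hzero => ?_⟩
  have hmn' : (inl m + inr b : DualNumber ℂ) * (inl n + inr (-(n ^ 2 * b))) = 1 := by
    ext
    · simp [hmn]
    · simp
      linear_combination -n * b * hmn
  have hx' : (inl x + inr 1 : DualNumber ℂ) * ((inl m + inr b) ^ 2 + (inl l + inr e))
      = (inl l + inr e) * (inl m + inr b) ^ 2 + 1 := by
    ext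
    · simp [hx]
    · simp [pow_two]
      linear_combination he
  have hc : twistTrace ((inl m + inr b : DualNumber ℂ) ^ 2 + (inl n + inr (-(n ^ 2 * b))) ^ 2)
      (inl x + inr 1) = inl (twistTrace (m ^ 2 + n ^ 2) x) := by
    rw [twistTrace, twistTrace]
    ext
    · simp
    · simp [pow_two]
      linear_combination 2 * (1 - x) * hb + hμ
  rw [twistA_eq hmn' hx'] at hzero
  have u1 : IsUnit ((inl m + inr b : DualNumber ℂ) ^ 2 + (inl l + inr e)) := by
    rw [isUnit_iff_isUnit_fst]; simpa using hD
  have u2 : IsUnit (inl m + inr b : DualNumber ℂ) := by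
    rw [isUnit_iff_isUnit_fst]; simpa using hm
  have hH := ((u1.pow _).mul ((u2.pow 2).pow _)).mul_right_eq_zero.1 hzero
  have key := one_sub_mul_twistH
    ((inl m + inr b : DualNumber ℂ) ^ 2 + (inl n + inr (-(n ^ 2 * b))) ^ 2) (inl x + inr 1) p
  rw [hH, mul_zero, hc, chebS_inl, chebS_inl] at key
  have hS := chebS_sq_add_sq (twistTrace (m ^ 2 + n ^ 2) x) (p - 1)
  rw [show p - 1 - 1 = p - 2 by ring] at hS
  generalize twistTrace (m ^ 2 + n ^ 2) x = c at *
  have k1 := congrArg fst key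
  have k2 := congrArg snd key
  simp at k1 k2
  generalize chebS c (p - 1) = S at *
  generalize chebS c (p - 2) = T at *
  obtain rfl : T = S := (sub_eq_zero.1 k2.symm)
  exact one_ne_zero (by linear_combination -hS + T * k1 : (1 : ℂ) = 0)

open MvPolynomial

/-- The polynomial `B_{K_p}`, as a polynomial in `l` and `m`. -/
noncomputable def twistPoly (R : Type*) [CommRing R] (p : ℤ) : MvPolynomial (Fin 2) R :=
  twistA p (X 0) (X 1)

theorem aeval_twistPoly {R S : Type*} [CommRing R] [CommRing S] [Algebra R S] (p : ℤ)
    (v : Fin 2 → S) : aeval v (twistPoly R p) = twistA p (v 0) (v 1) := by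
  have h := map_twistA (aeval v : MvPolynomial (Fin 2) R →ₐ[R] S).toRingHom p (X 0) (X 1)
  simpa [twistPoly] using h

theorem map_twistPoly {R S : Type*} [CommRing R] [CommRing S] (f : R →+* S) (p : ℤ) :
    map f (twistPoly R p) = twistPoly S p := by
  rw [twistPoly, map_twistA, map_X, map_X, twistPoly]

theorem Irreducible.not_dvd_X_one_sub_C {p : ℤ} {f : MvPolynomial (Fin 2) ℂ} (hf : Irreducible f)
    (hfP : f ∣ (X 0 - 1) * twistPoly ℂ p) (c : ℂ) : ¬ f ∣ X 1 - C c := by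
  intro hd
  have hi := irreducible_X_sub_C (1 : Fin 2) c
  rcases hi.prime.dvd_or_dvd ((hf.associated_of_dvd hi hd).symm.dvd.trans hfP) with h | h
  · simpa [sub_eq_zero] using map_dvd (aeval ![2, c]) h
  · obtain ⟨l, hl⟩ := exists_twistA_ne_zero c p
    have h' := map_dvd (aeval ![l, c]) h
    rw [aeval_twistPoly] at h'
    simp at h'
    exact hl h'

/-- Every component of the curve `(l - 1) B_{K_p} = 0` has points with `m ≠ 0` and `m⁴ ≠ 1`
outside any given curve that does not contain it. -/
theorem Irreducible.exists_point_twistPoly {p : ℤ} {f g : MvPolynomial (Fin 2) ℂ}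
    (hf : Irreducible f) (hfP : f ∣ (X 0 - 1) * twistPoly ℂ p) (hg : ¬ f ∣ g) :
    ∃ v : Fin 2 → ℂ, aeval v f = 0 ∧ aeval v g ≠ 0 ∧ v 1 ≠ 0 ∧ v 1 ^ 4 ≠ 1 := by
  have hc := hf.not_dvd_X_one_sub_C hfP
  obtain ⟨v, hv, h⟩ := hf.exists_aeval_eq_zero (g := g * ((X 1 - C 0) * ((X 1 - C 1) *
    ((X 1 - C (-1)) * ((X 1 - C Complex.I) * (X 1 - C (-Complex.I))))))) (by
      simp only [hf.prime.dvd_mul, hg, hc, or_self, not_false_eq_true])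
  simp only [map_mul, map_sub, aeval_X, aeval_C, Algebra.algebraMap_self, RingHom.id_apply,
    mul_ne_zero_iff] at h
  obtain ⟨h1, h2, h3⟩ := h
  refine ⟨v, hv, h1, by simpa using h2, fun h4 => ?_⟩
  obtain ⟨h3, h5, h6, h7⟩ := h3
  refine mul_ne_zero h3 (mul_ne_zero h5 (mul_ne_zero h6 h7)) ?_
  linear_combination h4 + (1 - v 1 ^ 2) * Complex.I_sq

theorem vanishingIdeal_eigenvalueSet_le {p : ℤ} {f : MvPolynomial (Fin 2) ℂ}
    (hf : Irreducible f) (hfP : f ∣ (X 0 - 1) * twistPoly ℂ p) :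
    vanishingIdeal ℂ (twistKnot p).eigenvalueSet ≤ Ideal.span {f} := by
  intro g hg
  rw [Ideal.mem_span_singleton]
  by_contra hfg
  obtain ⟨v, hv, hgv, hm, hm4⟩ := hf.exists_point_twistPoly hfP hfg
  refine hgv (hg v (mem_eigenvalueSet_of_twistA_eq_zero hm hm4 ?_))
  have h := map_dvd (aeval v) hfP
  rw [hv, zero_dvd_iff, map_mul, aeval_twistPoly] at h
  simpa using h

theorem mem_vanishingIdeal_eigenvalueSet (p : ℤ) :
    (X 0 - 1) * twistPoly ℂ p ∈ vanishingIdeal ℂ (twistKnot p).eigenvalueSet := by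
  intro v hv
  rw [map_mul, aeval_twistPoly]
  simpa using twistA_eq_zero_of_mem_eigenvalueSet hv

theorem not_X_zero_sub_one_dvd_twistPoly (p : ℤ) : ¬ (X 0 - C 1) ∣ twistPoly ℂ p := by
  intro h
  have h' := map_dvd (aeval (1 : Fin 2 → ℂ)) h
  have h1 := twistA_pow_four (one_mul (1 : ℂ)) p
  rw [aeval_twistPoly] at h'
  simp at h' h1
  rw [h'] at h1
  exact absurd h1.symm (pow_ne_zero _ (by norm_num))

theorem mul_twistPoly_ne_zero (p : ℤ) : (X 0 - 1) * twistPoly ℂ p ≠ 0 :=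
  mul_ne_zero (irreducible_X_sub_C (0 : Fin 2) 1).ne_zero
    fun h => not_X_zero_sub_one_dvd_twistPoly p (h ▸ dvd_zero _)

theorem squarefree_mul_twistPoly (p : ℤ) : Squarefree ((X 0 - 1) * twistPoly ℂ p) := by
  have hi := irreducible_X_sub_C (0 : Fin 2) 1
  refine (squarefree_iff_irreducible_sq_not_dvd_of_ne_zero (mul_twistPoly_ne_zero p)).2
    fun f hf hff => ?_
  by_cases hd : f ∣ X 0 - C 1
  · have hX := (hf.associated_of_dvd hi hd).symm.dvd
    exact not_X_zero_sub_one_dvd_twistPoly p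
      ((mul_dvd_mul_iff_left hi.ne_zero).1 ((mul_dvd_mul hX hX).trans hff))
  · obtain ⟨v, hv, hl, hm, hm4⟩ :=
      hf.exists_point_twistPoly ((dvd_mul_right f f).trans hff) hd
    obtain ⟨r, hr⟩ := hf.prime.pow_dvd_of_dvd_mul_left 2 hd (by rw [pow_two]; exact hff)
    have hA : twistA p (v 0) (v 1) = 0 := by
      rw [← aeval_twistPoly (R := ℂ), hr, map_mul, map_pow, hv]; simp
    obtain ⟨l', m', h⟩ := exists_dualNumber_twistA_ne_zero hm hm4
      (fun h => hl (by simp [h])) hA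
    -- along every tangent vector at `v`, the polynomial `f²` vanishes to second order
    let w : Fin 2 → DualNumber ℂ := ![inl (v 0) + inr l', inl (v 1) + inr m']
    have hw : fst (aeval w f) = 0 := by
      have h0 : (fstHom ℂ ℂ ℂ).comp (aeval w) = aeval v := by
        ext i
        fin_cases i <;> simp [w]
      rw [← hv, ← h0]; simp
    have hw2 : aeval w f ^ 2 = 0 := by
      ext <;> simp [pow_two, hw]
    refine h ?_
    have h0 := aeval_twistPoly (R := ℂ) p w
    rw [hr, map_mul, map_pow, hw2, zero_mul] at h0
    exact h0.symm

end Reduced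

/-! ### The A-polynomial of a twist knot -/

section APolynomial

open MvPolynomial

theorem twistA_zero_one {R : Type*} [CommRing R] (p : ℤ) : twistA p (0 : R) 1 = 1 := by
  rw [twistA_eq (one_mul 1) (x := 1 ^ 2 + 1 ^ 2 - 1) (by ring), twistH_sub_one]
  simp

theorem isReducedAPolynomial_twistPoly (p : ℤ) :
    IsReducedAPolynomial (twistKnot p) (twistPoly ℤ p) := by
  refine ⟨fun c hc => ?_, ?_⟩
  · -- the value at `l = 0`, `m = 1` is `-1`
    have h := map_dvd (aeval (![0, 1] : Fin 2 → ℤ)) hc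
    rw [map_mul, aeval_twistPoly] at h
    simp [twistA_zero_one] at h
    exact isUnit_of_dvd_one h
  · obtain ⟨F, h1, h2⟩ := (squarefree_mul_twistPoly p).exists_eq_finprod
      (mul_twistPoly_ne_zero p) (irreducible_X_sub_C 0 1) (by simp)
    rw [curveComponents_eq (mul_twistPoly_ne_zero p) (mem_vanishingIdeal_eigenvalueSet p)
      fun f hf hfP => vanishingIdeal_eigenvalueSet_le hf hfP]
    exact ⟨F, h1, by rw [← h2, map_mul, map_twistPoly]; simp⟩

theorem twistB_laurentH (p : ℤ) :
    twistB p (laurentH p) = algebraMap (MvPolynomial (Fin 2) ℤ) RatLM (twistPoly ℤ p) := by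
  have hD : varM ^ 2 + varL ≠ 0 := by
    have hi := IsFractionRing.injective (MvPolynomial (Fin 2) ℤ) RatLM
    rw [varM, varL, ← map_pow, ← map_add, Ne, map_eq_zero_iff _ hi]
    intro h
    simpa using congrArg (aeval (![1, 0] : Fin 2 → ℤ)) h
  rw [twistPoly, map_twistA]
  change _ = twistA p varL varM
  rw [twistA_eq (mul_inv_cancel₀ varM_ne_zero) (div_mul_cancel₀ _ hD), twistB, evalAt_laurentH,
    twistDeg]
  split_ifs with hp
  · obtain ⟨k, rfl⟩ : ∃ k : ℕ, p = k + 1 := ⟨p.natAbs - 1, by omega⟩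
    rw [show (2 * ((k : ℤ) + 1) - 1) = ((2 * (k + 1) - 1 : ℕ) : ℤ) by omega,
      show ((k : ℤ) + 1) = ((k + 1 : ℕ) : ℤ) by push_cast; rfl, zpow_natCast, zpow_natCast,
      Int.natAbs_natCast]
  · rw [Int.abs_eq_natAbs, show (2 * (p.natAbs : ℤ)) = ((2 * p.natAbs : ℕ) : ℤ) by push_cast; rfl,
      zpow_natCast, zpow_natCast]

end APolynomial

open Polynomial LaurentPolynomial in
theorem theorem2p2 :
    -- `f₀`, `f₁`, `f₂` are the ratios of neighbouring values of the summand
    (∀ q : RatFunc ℚ, q = RatFunc.X → ∀ (p : ℤ) (n k l : ℕ), l ≤ k → k < n →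
      masbaumF p q n k l ≠ 0 ∧
      masbaumF p q (n + 1) k l / masbaumF p q n k l = ratio0 q (q ^ n) (q ^ k) (q ^ l) ∧
      (k + 1 < n →
        masbaumF p q n (k + 1) l / masbaumF p q n k l = ratio1 q (q ^ n) (q ^ k) (q ^ l)) ∧
      (l + 1 ≤ k →
        masbaumF p q n k (l + 1) / masbaumF p q n k l = ratio2 p q (q ^ n) (q ^ k) (q ^ l))) ∧
    ∃ h : ℤ → ℤ[T;T⁻¹][X],
      -- the recursion that determines `h_p` for all integers `p`
      h 0 = 1 ∧
      h 1 = Polynomial.C (T (-2)) * (Polynomial.C (T 4) - X * Polynomial.C (T 2) + 1) ∧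
      (∀ p : ℤ, h p =
        Polynomial.C (T (-2)) * (Polynomial.C (T 4) - X * Polynomial.C (T 4) + X ^ 2 * Polynomial.C (T 2) + Polynomial.C (T 2) + 1 - X) * h (p - 1)
          - h (p - 2)) ∧
      ∀ p : ℤ,
        -- the consequences of the three equations
        (∀ (K : Type*) [Field K] (m l x y : K) (hm : m ≠ 0), x ≠ 0 → y ≠ 0 →
          HasValueAt spec0 ![m ^ 2, x, y] l →
          HasValueAt spec1 ![m ^ 2, x, y] 1 →
          HasValueAt (spec2 p) ![m ^ 2, x, y] 1 →
          x * (m ^ 2 + l) = l * m ^ 2 + 1 ∧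
          (m ^ 2 + l ≠ 0 → x = (l * m ^ 2 + 1) / (m ^ 2 + l)) ∧
          (y + 1) * (1 - x) * y ^ p * evalAt m hm x (h p) = 0) ∧
        -- `B_{K_p} = A_{K_p}`
        ∃ A : MvPolynomial (Fin 2) ℤ,
          IsReducedAPolynomial (twistKnot p) A ∧
          twistB p (h p) = algebraMap (MvPolynomial (Fin 2) ℤ) RatLM A := by
  refine ⟨?_, laurentH, twistH_zero _ _, laurentH_one, laurentH_rec, fun p => ⟨?_, ?_⟩⟩
  · rintro q rfl p n k l hlk hkn
    have hq (j : ℕ) (hj : 0 < j) := ratFunc_X_pow_ne_one hj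
    exact ⟨masbaumF_ne_zero RatFunc.X_ne_zero hq p n k l,
      masbaumF_ratio0 RatFunc.X_ne_zero hq p l hkn,
      masbaumF_ratio1 RatFunc.X_ne_zero hq p hlk,
      masbaumF_ratio2 RatFunc.X_ne_zero hq p n⟩
  · intro K _ m l x y hm hx hy h0 h1 h2
    refine ⟨h0.eq_of_spec0, fun hD => (eq_div_iff hD).2 h0.eq_of_spec0, ?_⟩
    rw [evalAt_laurentH]
    exact twistH_eq_zero_of_equations hm hx hy h1.eq_of_spec1 (h2.eq_of_spec2 hy)
  · exact ⟨_, isReducedAPolynomial_twistPoly p, twistB_laurentH p⟩
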